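/- Setting. Let $\langle\mathcal S,\mathcal A,P,r,\gamma\rangle$ be a discounted MDP with measurable state space $\mathcal S$, finite action space $\mathcal A$, probability kernel $P(ds'|s,a)$, bounded measurable reward $r$ and $\gamma\in(0,1)$. A policy is a (measurable) map $\pi:\mathcal S\to\mathcal A$; put $r_\pi(s)=r(s,\pi(s))$, $P_\pi(ds'|s)=P(ds'|s,\pi(s))$, $T_\pi f=r_\pi+\gamma P_\pi f$; $v_\pi(s)=\mathbb E[\sum_{t\ge0}\gamma^t r_\pi(s_t)\mid s_0=s,\ s_{t+1}\sim P_\pi(\cdot|s_t)]$ and $v_*=\sup_\pi v_\pi$. Let $m\ge1$ be an integer, $v_0$ a bounded measurable function on $\mathcal S$, $\epsilon_k$ $(k\ge1)$ bounded measurable functions, $\epsilon'_k$ $(k\ge1)$ measurable functions, and let $v_k=(T_{\pi_k})^m v_{k-1}+\epsilon_k$ for $k\ge1$. A policy $\pi$ is $e$-greedy with respect to $f$ if $T_{\pi'}f\le T_{\pi}f+e$ pointwise for every policy $\pi'$. - AMPI (AMPI-V): $\pi_k$ is $\epsilon'_k$-greedy with respect to $v_{k-1}$, for all $k\ge1$.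 - CBMPI: $\pi_{k+1}$ is $\epsilon'_{k+1}$-greedy with respect to $(T_{\pi_k})^m v_{k-1}$, for all $k\ge1$, and $\pi_1$ is $\epsilon'_1$-greedy with respect to $v_0$. - AMPI-Q: the functions $v_k$ are replaced by functions $Q_k$ on $\mathcal S\times\mathcal A$, with $[T_\pi Q](s,a)=r(s,a)+\gamma\int Q(s',\pi(s'))P(ds'|s,a)$ and $\pi_k(s)\in\arg\max_a Q_{k-1}(s,a)$. Let $\rho,\mu$ be probability distributions over $\mathcal S$ such that $\rho P_{\pi_1}\cdots P_{\pi_j}\ll\mu$ for all $j\ge0$ and all policies $\pi_1,\dots,\pi_j$. Let $1\le p<\infty$ and $q,q'\in[1,\infty]$ with $\frac1q+\frac1{q'}=1$. Define $$c_q(j)=\sup_{\pi_1,\dots,\pi_j}\Big\|\frac{d(\rho P_{\pi_1}\cdots P_{\pi_j})}{d\mu}\Big\|_{q,\mu},\qquad \mathcal C_q^{l,k,d}=\frac{(1-\gamma)^2}{\gamma^l-\gamma^k}\sum_{i=l}^{k-1}\sum_{j=i}^\infty\gamma^j c_q(j+d)\in[0,\infty],$$ (for $l\ge k$, where the sum is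 empty, $\mathcal C_q^{l,k,d}=0$) and, with $d_0=v_*-v_0$ and $b_0=v_0-T_{\pi_1}v_0$, $$g(k)=\frac{2\gamma^k}{1-\gamma}\big(\mathcal C_q^{k,k+1,0}\big)^{1/p}\min\big(\|d_0\|_{pq',\mu},\|b_0\|_{pq',\mu}\big).$$ Theorem. For every $k\ge1$ (with $0\cdot\infty=0$ and with suprema over empty index sets, and the terms that contain them, equal to $0$), the loss of AMPI satisfies $$\|v_*-v_{\pi_k}\|_{p,\rho}\le\frac{2(\gamma-\gamma^k)(\mathcal C_q^{1,k,0})^{1/p}}{(1-\gamma)^2}\sup_{1\le j\le k-1}\|\epsilon_j\|_{pq',\mu}+\frac{(1-\gamma^k)(\mathcal C_q^{0,k,0})^{1/p}}{(1-\gamma)^2}\sup_{1\le j\le k}\|\epsilon'_j\|_{pq',\mu}+g(k),$$ and the loss of CBMPI satisfies $$\|v_*-v_{\pi_k}\|_{p,\rho}\le\frac{2\gamma^m(\gamma-\gamma^{k-1})(\mathcal C_q^{1,k-1,m})^{1/p}}{(1-\gamma)^2}\sup_{1\le j\le k-2}\|\epsilon_j\|_{pq',\mu}+\frac{(1-\gamma^k)(\mathcal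 C_q^{0,k,0})^{1/p}}{(1-\gamma)^2}\sup_{1\le j\le k}\|\epsilon'_j\|_{pq',\mu}+g(k).$$ For AMPI-Q the AMPI bound holds with no $\epsilon'$ term, everything being read on $\mathcal S\times\mathcal A$: $\rho,\mu$ are distributions over $\mathcal S\times\mathcal A$, $P_\pi$ is the kernel $(s,a)\mapsto(s',\pi(s'))$ with $s'\sim P(\cdot|s,a)$, absolute continuity is needed for $j\ge1$ only, $v_\pi,v_*$ are replaced by the action-value functions $Q_\pi$ and $Q_*=\sup_\pi Q_\pi$ (so the loss is $Q_*-Q_{\pi_k}$), and $d_0=Q_*-Q_0$, $b_0=Q_0-T_{\pi_1}Q_0$. -/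

import Mathlib

open MeasureTheory ProbabilityTheory
open scoped ENNReal

/-- A discounted Markov decision process with measurable state space `S`, action space `A`,
transition kernel `P (ds' | s, a)`, bounded reward `r` and discount factor `γ ∈ (0, 1)`. -/
structure MDP (S A : Type*) [MeasurableSpace S] [MeasurableSpace A] where
  P : Kernel (S × A) S
  markov : IsMarkovKernel P
  r : S → A → ℝ
  measurable_r : Measurable (Function.uncurry r)
  bounded_r : ∃ Rmax : ℝ, ∀ s a, |r s a| ≤ Rmax
  γ : ℝ
  γ_pos : 0 < γ
  γ_lt_one : γ < 1

/-- Deterministic (stationary, measurable) policies. -/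
def Policy (S A : Type*) [MeasurableSpace S] [MeasurableSpace A] : Type _ :=
  {π : S → A // Measurable π}

/-- The data on which Bellman operators act: for each policy, a Markov kernel and a reward on a
space `X`, and a discount factor. It is only used for the two families built from an MDP below:
`MDP.onStates` (on `S`) and `MDP.onStateActions` (on `S × A`). -/
structure ControlledChain (Pol X : Type*) [MeasurableSpace X] where
  kernel : Pol → Kernel X X
  markov : ∀ π, IsMarkovKernel (kernel π)
  reward : Pol → X → ℝ
  γ : ℝ

/-- On states: `P_π (ds' | s) = P (ds' | s, π s)` and `r_π s = r (s, π s)`. -/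
noncomputable def MDP.onStates {S A : Type*} [MeasurableSpace S] [MeasurableSpace A]
    (M : MDP S A) : ControlledChain (Policy S A) S where
  kernel π := M.P.comap (fun s => (s, π.1 s)) (measurable_id.prodMk π.2)
  markov π := by
    have := M.markov
    infer_instance
  reward π s := M.r s (π.1 s)
  γ := M.γ

/-- On state-action pairs: from `(s, a)` the chain moves to `(s', π s')` with
`s' ∼ P (· | s, a)`, and the reward is `r (s, a)`. -/
noncomputable def MDP.onStateActions {S A : Type*} [MeasurableSpace S] [MeasurableSpace A]
    (M : MDP S A) : ControlledChain (Policy S A) (S × A) where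
  kernel π := M.P.map (fun s' => (s', π.1 s'))
  markov π := by
    have := M.markov
    exact Kernel.IsMarkovKernel.map _ (measurable_id.prodMk π.2)
  reward _ x := M.r x.1 x.2
  γ := M.γ

namespace ControlledChain

variable {Pol X : Type*} [MeasurableSpace X] (C : ControlledChain Pol X)

/-- The kernel giving the conditional law of the state at time `n + 1` given the history up to
time `n`, under policy `π`. -/
noncomputable def stepKernel (π : Pol) (n : ℕ) :
    Kernel ((_ : Finset.Iic n) → X) X :=
  (C.kernel π).comap (fun h => h ⟨n, Finset.mem_Iic.2 le_rfl⟩) (measurable_pi_apply _)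

instance (π : Pol) (n : ℕ) : IsMarkovKernel (C.stepKernel π n) := by
  have := C.markov π
  unfold stepKernel
  infer_instance

/-- The law of the trajectory `(x_0, x_1, …)` with `x_0 = x` and
`x_{t+1} ∼ kernel π (· | x_t)`. -/
noncomputable def trajLaw (π : Pol) (x : X) : Measure (ℕ → X) :=
  Kernel.traj (X := fun _ => X) (C.stepKernel π) 0 (fun _ => x)

/-- Value of a policy: expected discounted sum of rewards. On states this is `v_π`, on
state-action pairs it is `Q_π`. -/
noncomputable def value (π : Pol) (x : X) : ℝ :=
  ∫ ω, ∑' t : ℕ, C.γ ^ t * C.reward π (ω t) ∂(C.trajLaw π x)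

/-- Optimal value: pointwise supremum over all policies (`v_*`, resp. `Q_*`). -/
noncomputable def optValue (x : X) : ℝ := ⨆ π : Pol, C.value π x

/-- Bellman operator `T_π f = r_π + γ P_π f`. -/
noncomputable def bellman (π : Pol) (f : X → ℝ) (x : X) : ℝ :=
  C.reward π x + C.γ * ∫ y, f y ∂(C.kernel π x)

/-- The measure `ρ P_{π₁} P_{π₂} ⋯ P_{πⱼ}` for a list `[π₁, …, πⱼ]` of policies. -/
noncomputable def push (ρ : Measure X) : List Pol → Measure X
  | [] => ρ
  | π :: l => push (ρ.bind (C.kernel π)) l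

/-- `c_q(j) = sup_{π₁, …, πⱼ} ‖ d(ρ P_{π₁} ⋯ P_{πⱼ}) / dμ ‖_{q, μ}`; meaningful when these
measures are absolutely continuous with respect to `μ`. -/
noncomputable def conc (ρ μ : Measure X) (q : ℝ≥0∞) (j : ℕ) : ℝ≥0∞ :=
  ⨆ l : {l : List Pol // l.length = j}, eLpNorm ((C.push ρ l.1).rnDeriv μ) q μ

/-- `𝒞_q^{l,k,d} = (1-γ)² / (γ^l - γ^k) · ∑_{i=l}^{k-1} ∑_{j ≥ i} γ^j c_q(j + d)`, for `l < k`. -/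
noncomputable def concCoeff (ρ μ : Measure X) (q : ℝ≥0∞) (l k d : ℕ) : ℝ≥0∞ :=
  ENNReal.ofReal ((1 - C.γ) ^ 2 / (C.γ ^ l - C.γ ^ k)) *
    ∑ i ∈ Finset.Ico l k, ∑' n : ℕ, ENNReal.ofReal (C.γ ^ (i + n)) * C.conc ρ μ q (i + n + d)

/-- The initial-error term `g(k)`, with `d₀ = v_* - v₀` and `b₀ = v₀ - T_{π₁} v₀`. -/
noncomputable def initTerm (ρ μ : Measure X) (p : ℝ) (q q' : ℝ≥0∞) (k : ℕ)
    (v₀ : X → ℝ) (π₁ : Pol) : ℝ≥0∞ :=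
  ENNReal.ofReal (2 * C.γ ^ k / (1 - C.γ)) * C.concCoeff ρ μ q k (k + 1) 0 ^ (1 / p) *
    min (eLpNorm (fun x => C.optValue x - v₀ x) (ENNReal.ofReal p * q') μ)
      (eLpNorm (fun x => v₀ x - C.bellman π₁ v₀ x) (ENNReal.ofReal p * q') μ)

/-- Bounded measurable functions. -/
def BddMeasurable (f : X → ℝ) : Prop := Measurable f ∧ ∃ B : ℝ, ∀ x, |f x| ≤ B

/-- `π` is a greedy policy with respect to `v` up to the error `e`:
`T_{π'} v ≤ T_π v + e` for every policy `π'`. -/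
def ApproxGreedy (π : Pol) (v e : X → ℝ) : Prop :=
  ∀ (π' : Pol) (x : X), C.bellman π' v x ≤ C.bellman π v x + e x

/-- `v_k = (T_{π_k})^m v_{k-1} + ε_k` for `k ≥ 1`, with a bounded measurable initial value and
bounded measurable evaluation step errors. -/
structure EvalStep (m : ℕ) (v ε : ℕ → X → ℝ) (π : ℕ → Pol) : Prop where
  init : BddMeasurable (v 0)
  err : ∀ k, BddMeasurable (ε (k + 1))
  eval : ∀ k x, v (k + 1) x = (C.bellman (π (k + 1)))^[m] (v k) x + ε (k + 1) x

/-- AMPI (the abstract model of AMPI-V): `π_k` is `ε'_k`-greedy with respect to `v_{k-1}` and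
`v_k = (T_{π_k})^m v_{k-1} + ε_k`, for all `k ≥ 1`. -/
structure IsAMPI (m : ℕ) (v ε ε' : ℕ → X → ℝ) (π : ℕ → Pol) : Prop
    extends C.EvalStep m v ε π where
  greedyErr : ∀ k, Measurable (ε' (k + 1))
  greedy : ∀ k, C.ApproxGreedy (π (k + 1)) (v k) (ε' (k + 1))

/-- The value before approximation: `w_0 = v_0` and `w_k = (T_{π_k})^m v_{k-1}` for `k ≥ 1`. -/
noncomputable def preValue (m : ℕ) (v : ℕ → X → ℝ) (π : ℕ → Pol) : ℕ → X → ℝ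
  | 0 => v 0
  | k + 1 => (C.bellman (π (k + 1)))^[m] (v k)

/-- CBMPI: `v_k = (T_{π_k})^m v_{k-1} + ε_k` and `π_{k+1}` is `ε'_{k+1}`-greedy with respect to
`(T_{π_k})^m v_{k-1}`, for all `k ≥ 1`; the initial policy `π_1` is arbitrary and `ε'_1` is its
greedy step error with respect to `v_0`. -/
structure IsCBMPI (m : ℕ) (v ε ε' : ℕ → X → ℝ) (π : ℕ → Pol) : Prop
    extends C.EvalStep m v ε π where
  greedyErr : ∀ k, Measurable (ε' (k + 1))
  greedy : ∀ k, C.ApproxGreedy (π (k + 1)) (C.preValue m v π k) (ε' (k + 1))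

end ControlledChain

/-- AMPI-Q: `π_k(s) ∈ argmax_a Q_{k-1}(s, a)` and `Q_k = (T_{π_k})^m Q_{k-1} + ε_k`, for all
`k ≥ 1`, with the Bellman operators on state-action pairs. -/
structure MDP.IsAMPIQ {S A : Type*} [MeasurableSpace S] [MeasurableSpace A] (M : MDP S A)
    (m : ℕ) (Q ε : ℕ → S × A → ℝ) (π : ℕ → Policy S A) : Prop
    extends M.onStateActions.EvalStep m Q ε π where
  greedy : ∀ k s a, Q k (s, a) ≤ Q k (s, (π (k + 1)).1 s)

/-!
# Error propagation in approximate modified policy iteration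

The three algorithms are instances of one scheme on a `ControlledChain`. AMPI-Q is AMPI on
state-action pairs, and a policy that is greedy for `Q` has greedy step error zero. CBMPI is AMPI
for the values before approximation `w_k = (T_{π_k})^m v_{k-1}`: since `π_{k+1}` is greedy for
`w_k`, the error `ε_k` only acts through `(T_{π_{k+1}})^m (w_k + ε_k) - (T_{π_{k+1}})^m w_k`, which
is a new error bounded by `(γ P_{π_{k+1}})^m |ε_k|` (`IsCBMPI.isAMPI`, `IsCBMPI.delayedError_le`).
This is where the factor `γ^m` and the shift by `m` in the coefficient come from.

For AMPI, all estimates are made on positive parts. The products of kernels `γ P_π` that occur are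
replaced by powers of one operator, `Γ g = γ max_π P_π g` on functions with values in `[0, ∞]`
(`maxStep`). It is monotone and sublinear, and because the action space is finite the maximum is
attained by a measurable policy, so that `Γ^n g = γ^n P_{π_1} ⋯ P_{π_n} g` for some policies. With
`δ_k` and `β_k` the positive parts of `v_* - v_k` and `v_k - T_{π_{k+1}} v_k`, one iteration gives
* `β_{k+1} ≤ Γ^m β_k + |ε_{k+1}| + Γ |ε_{k+1}| + ε'_{k+2}`,
* `δ_{k+1} ≤ Γ δ_k + ε'_{k+1} + ∑_{1 ≤ j < m} Γ^j β_k + |ε_{k+1}|`,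
* `v_* - v_{π_{k+1}} ≤ Γ δ_k + ε'_{k+1} + ∑_{j ≥ 1} Γ^j β_k`.

In the combination `Γ^{n+1} δ_k + ∑_{j ≥ n+1} Γ^j β_k + Γ^n ε'_{k+1}` (`potential`) the parameter
`m` cancels, because `Γ^m` moves the tail exactly to where the finite sum ends. Unrolling it
gives the pointwise bound `IsAMPI.loss_le`: the loss is at most a sum of tails
`∑_{j ≥ i} Γ^j g` with `g` one of `|ε_{k-i}|`, `ε'_{k-i}`, and `|v_* - v_0|` or
`|v_0 - T_{π_1} v_0|`. The last two are exchanged by `v_0 - T_{π_1} v_0 ≤ |d_0| + Γ |d_0| + ε'_1`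
and by `d_0 ≤ Γ d_0⁺ + |b_0| + ε'_1`, where `d_0 = v_* - v_0` and `b_0 = v_0 - T_{π_1} v_0`.

In norm, Jensen's inequality for the kernels and Hölder's inequality for the density of
`ρ P_{π_1} ⋯ P_{π_n}` give `‖Γ^n g‖_{p,ρ} ≤ γ^n c_q(n)^{1/p} ‖g‖_{pq',μ}`
(`IsRegular.eLpNorm_iterate_le`). The sums of the `γ^n c_q(n)^{1/p}` are compared with the
coefficients by concavity of `x ↦ x^{1/p}` (`IsRegular.sum_tsum_conc_le`).
-/

open Filter Topology

/-! ### Regular controlled chains -/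

namespace ControlledChain

variable {Pol X : Type*} [MeasurableSpace X]

instance (C : ControlledChain Pol X) (π : Pol) : IsMarkovKernel (C.kernel π) := C.markov π

/-- The properties of a controlled chain that the error analysis uses: a discount factor in
`(0, 1)`, rewards that are measurable and uniformly bounded, and the existence of policies that
maximize, at all points simultaneously, a Bellman update or the expectation of a nonnegative
function at the next step. The last two hold when the action space is finite. -/
structure IsRegular (C : ControlledChain Pol X) : Prop where
  γ_pos : 0 < C.γ
  γ_lt_one : C.γ < 1
  measurable_reward : ∀ π, Measurable (C.reward π)
  bounded_reward : ∃ R : ℝ, ∀ π x, |C.reward π x| ≤ R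
  exists_greedy : ∀ f : X → ℝ, BddMeasurable f →
    ∃ π, ∀ π' x, C.bellman π' f x ≤ C.bellman π f x
  exists_max_lintegral : ∀ g : X → ℝ≥0∞, Measurable g →
    ∃ π, ∀ π' x, ∫⁻ y, g y ∂(C.kernel π' x) ≤ ∫⁻ y, g y ∂(C.kernel π x)

/-! ### Bounded measurable functions -/

namespace BddMeasurable

variable {f g : X → ℝ}

lemma const (c : ℝ) : BddMeasurable (fun _ : X => c) :=
  ⟨measurable_const, |c|, fun _ => le_rfl⟩

lemma add (hf : BddMeasurable f) (hg : BddMeasurable g) :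
    BddMeasurable (fun x => f x + g x) := by
  obtain ⟨hf, B, hB⟩ := hf
  obtain ⟨hg, B', hB'⟩ := hg
  exact ⟨hf.add hg, B + B', fun x => (abs_add_le _ _).trans (add_le_add (hB x) (hB' x))⟩

lemma const_mul (c : ℝ) (hf : BddMeasurable f) : BddMeasurable (fun x => c * f x) := by
  obtain ⟨hf, B, hB⟩ := hf
  refine ⟨hf.const_mul c, |c| * B, fun x => ?_⟩
  rw [abs_mul]
  exact mul_le_mul_of_nonneg_left (hB x) (abs_nonneg c)

lemma sub (hf : BddMeasurable f) (hg : BddMeasurable g) :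
    BddMeasurable (fun x => f x - g x) := by
  have := hf.add (hg.const_mul (-1))
  simpa [sub_eq_add_neg] using this

lemma integrable (hf : BddMeasurable f) (μ : Measure X) [IsFiniteMeasure μ] :
    Integrable f μ := by
  obtain ⟨hf, B, hB⟩ := hf
  exact Integrable.of_bound hf.aestronglyMeasurable B (Eventually.of_forall hB)

lemma integral_kernel (hf : BddMeasurable f) (κ : Kernel X X) [IsMarkovKernel κ] :
    BddMeasurable (fun x => ∫ y, f y ∂(κ x)) := by
  obtain ⟨hf, B, hB⟩ := hf
  refine ⟨hf.stronglyMeasurable.integral_kernel.measurable, B, fun x => ?_⟩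
  have := norm_integral_le_of_norm_le_const (μ := κ x) (f := f) (C := B) (Eventually.of_forall hB)
  simpa using this

end BddMeasurable

variable {C : ControlledChain Pol X}

lemma tendsto_bellman {f : ℕ → X → ℝ} {g : X → ℝ} {B : ℝ}
    (hf : ∀ n, Measurable (f n)) (hB : ∀ n x, |f n x| ≤ B)
    (h : ∀ x, Tendsto (fun n => f n x) atTop (𝓝 (g x))) (π : Pol) (x : X) :
    Tendsto (fun n => C.bellman π (f n) x) atTop (𝓝 (C.bellman π g x)) := by
  unfold bellman
  refine tendsto_const_nhds.add (Tendsto.const_mul _ ?_)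
  exact tendsto_integral_of_dominated_convergence (fun _ => B)
    (fun n => (hf n).aestronglyMeasurable) (integrable_const B)
    (fun n => Eventually.of_forall (hB n)) (Eventually.of_forall h)

namespace IsRegular

lemma bddMeasurable_reward (hC : C.IsRegular) (π : Pol) : BddMeasurable (C.reward π) := by
  obtain ⟨R, hR⟩ := hC.bounded_reward
  exact ⟨hC.measurable_reward π, R, hR π⟩

lemma nonempty (hC : C.IsRegular) : Nonempty Pol :=
  ⟨(hC.exists_greedy _ (BddMeasurable.const 0)).choose⟩

lemma bddMeasurable_bellman (hC : C.IsRegular) {f : X → ℝ} (hf : BddMeasurable f) (π : Pol) :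
    BddMeasurable (C.bellman π f) :=
  (hC.bddMeasurable_reward π).add ((hf.integral_kernel (C.kernel π)).const_mul C.γ)

lemma bddMeasurable_bellman_iterate (hC : C.IsRegular) {f : X → ℝ} (hf : BddMeasurable f)
    (π : Pol) (n : ℕ) : BddMeasurable ((C.bellman π)^[n] f) := by
  induction n with
  | zero => exact hf
  | succ n ih =>
    rw [Function.iterate_succ_apply']
    exact hC.bddMeasurable_bellman ih π

lemma bellman_mono (hC : C.IsRegular) {f g : X → ℝ} (hf : BddMeasurable f)
    (hg : BddMeasurable g) (h : ∀ x, f x ≤ g x) (π : Pol) (x : X) :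
    C.bellman π f x ≤ C.bellman π g x := by
  unfold bellman
  have := integral_mono (hf.integrable (C.kernel π x)) (hg.integrable (C.kernel π x)) h
  have := mul_le_mul_of_nonneg_left this hC.γ_pos.le
  linarith

/-- A ball in the sup norm that is invariant under all Bellman operators. -/
lemma exists_bellman_invariant_bound (hC : C.IsRegular) :
    ∃ B : ℝ, 0 ≤ B ∧ ∀ (π : Pol) (f : X → ℝ), (∀ x, |f x| ≤ B) → ∀ x, |C.bellman π f x| ≤ B := by
  obtain ⟨R, hR⟩ := hC.bounded_reward
  have h1 : 0 < 1 - C.γ := sub_pos.2 hC.γ_lt_one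
  refine ⟨|R| / (1 - C.γ), by positivity, fun π f hf x => ?_⟩
  have h2 := norm_integral_le_of_norm_le_const (μ := C.kernel π x) (f := f)
    (C := |R| / (1 - C.γ)) (Eventually.of_forall hf)
  simp only [probReal_univ, mul_one, Real.norm_eq_abs] at h2
  have h3 : |C.γ * ∫ y, f y ∂(C.kernel π x)| ≤ C.γ * (|R| / (1 - C.γ)) := by
    rw [abs_mul, abs_of_pos hC.γ_pos]
    exact mul_le_mul_of_nonneg_left h2 hC.γ_pos.le
  have h4 : |R| + C.γ * (|R| / (1 - C.γ)) = |R| / (1 - C.γ) := by field_simp; ring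
  exact (abs_add_le _ _).trans (h4 ▸ add_le_add ((hR π x).trans (le_abs_self R)) h3)

end IsRegular

/-! ### The trajectory law and the value of a policy -/

instance (π : Pol) (x : X) : IsProbabilityMeasure (C.trajLaw π x) := by
  unfold trajLaw; infer_instance

lemma integral_trajLaw_zero (π : Pol) (x : X) {f : X → ℝ} (hf : Measurable f) :
    ∫ ω, f (ω 0) ∂(C.trajLaw π x) = f x := by
  have h1 : (C.trajLaw π x).map (Preorder.frestrictLe 0) =
      Measure.dirac (fun _ => x) := by
    have := Kernel.traj_map_frestrictLe_apply (X := fun _ => X) (κ := C.stepKernel π) 0 0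
      (fun _ => x)
    rw [trajLaw, this, Kernel.partialTraj_self, Kernel.id_apply]
  have h2 := integral_map (μ := C.trajLaw π x) (φ := Preorder.frestrictLe (π := fun _ => X) 0)
    (by fun_prop) (f := fun h => f (h ⟨0, Finset.mem_Iic.2 le_rfl⟩))
    ((hf.comp (measurable_pi_apply _)).aestronglyMeasurable)
  rw [h1, integral_dirac' (fun h : (_ : Finset.Iic 0) → X => f (h ⟨0, Finset.mem_Iic.2 le_rfl⟩)) _
    ((hf.comp (measurable_pi_apply _)).stronglyMeasurable)] at h2
  exact h2.symm

/-- The Markov property at time `t`: the expectation of `f` at time `t + 1` is the expectation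
of `P_π f` at time `t`. -/
lemma integral_trajLaw_succ (π : Pol) (x : X) (t : ℕ) {f : X → ℝ} (hf : BddMeasurable f) :
    ∫ ω, f (ω (t + 1)) ∂(C.trajLaw π x) =
      ∫ ω, ∫ y, f y ∂(C.kernel π (ω t)) ∂(C.trajLaw π x) := by
  have hm : Measurable (fun ω : ℕ → X => ω (t + 1)) := measurable_pi_apply _
  have hP := hf.integral_kernel (C.kernel π)
  have hint : Integrable (fun ω : ℕ → X => f (ω (t + 1)))
      ((Kernel.traj (X := fun _ => X) (C.stepKernel π) t ∘ₖ
        Kernel.partialTraj (X := fun _ => X) (C.stepKernel π) 0 t) (fun _ => x)) := by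
    obtain ⟨hf, B, hB⟩ := hf
    exact Integrable.of_bound (hf.comp hm).aestronglyMeasurable B
      (Eventually.of_forall fun ω => hB _)
  have h1 : ∀ h : (_ : Finset.Iic t) → X,
      ∫ ω, f (ω (t + 1)) ∂(Kernel.traj (X := fun _ => X) (C.stepKernel π) t h) =
        ∫ y, f y ∂(C.kernel π (h ⟨t, Finset.mem_Iic.2 le_rfl⟩)) := by
    intro h
    have h2 : (Kernel.traj (X := fun _ => X) (C.stepKernel π) t h).map (fun ω => ω (t + 1)) =
        C.kernel π (h ⟨t, Finset.mem_Iic.2 le_rfl⟩) := by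
      rw [← Kernel.map_apply _ hm, Kernel.map_traj_succ_self]
      rfl
    rw [← h2, integral_map hm.aemeasurable hf.1.aestronglyMeasurable]
  have h3 := Kernel.integral_comp hint
  rw [Kernel.traj_comp_partialTraj (Nat.zero_le t)] at h3
  rw [trajLaw, h3]
  simp_rw [h1]
  rw [← Kernel.traj_map_frestrictLe_apply, integral_map (by fun_prop)]
  · rfl
  · exact (hP.1.comp (measurable_pi_apply _)).aestronglyMeasurable

namespace IsRegular

/-- The `n`-step Bellman update is the expected discounted reward of the first `n` steps
followed by the terminal reward `f`. -/
lemma bellman_iterate_eq_sum (hC : C.IsRegular) (π : Pol) (x : X) (n : ℕ) :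
    ∀ {f : X → ℝ}, BddMeasurable f → (C.bellman π)^[n] f x =
      ∑ t ∈ Finset.range n, C.γ ^ t * ∫ ω, C.reward π (ω t) ∂(C.trajLaw π x) +
        C.γ ^ n * ∫ ω, f (ω n) ∂(C.trajLaw π x) := by
  have hint : ∀ {g : X → ℝ}, BddMeasurable g → ∀ t : ℕ,
      Integrable (fun ω : ℕ → X => g (ω t)) (C.trajLaw π x) := by
    rintro g ⟨hg, B, hB⟩ t
    exact Integrable.of_bound (hg.comp (measurable_pi_apply t)).aestronglyMeasurable B
      (Eventually.of_forall fun ω => hB _)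
  induction n with
  | zero =>
    intro f hf
    simp [integral_trajLaw_zero π x hf.1]
  | succ n ih =>
    intro f hf
    rw [Function.iterate_succ_apply, ih (hC.bddMeasurable_bellman hf π), Finset.sum_range_succ,
      integral_trajLaw_succ π x n hf]
    unfold bellman
    rw [integral_add (hint (hC.bddMeasurable_reward π) n)
      (hint ((hf.integral_kernel (C.kernel π)).const_mul C.γ) n), integral_const_mul]
    ring

lemma hasSum_value (hC : C.IsRegular) (π : Pol) (x : X) :
    HasSum (fun t : ℕ => C.γ ^ t * ∫ ω, C.reward π (ω t) ∂(C.trajLaw π x)) (C.value π x) := by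
  obtain ⟨R, hR⟩ := hC.bounded_reward
  have hm : ∀ t : ℕ, Measurable (fun ω : ℕ → X => C.γ ^ t * C.reward π (ω t)) := fun t =>
    ((hC.measurable_reward π).comp (measurable_pi_apply t)).const_mul _
  have hb : ∀ (t : ℕ) (ω : ℕ → X), ‖C.γ ^ t * C.reward π (ω t)‖ ≤ C.γ ^ t * R := by
    intro t ω
    rw [norm_mul, Real.norm_of_nonneg (pow_nonneg hC.γ_pos.le t)]
    exact mul_le_mul_of_nonneg_left (hR π _) (pow_nonneg hC.γ_pos.le t)
  have hi : ∀ t : ℕ, Integrable (fun ω : ℕ → X => C.γ ^ t * C.reward π (ω t))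
      (C.trajLaw π x) := fun t =>
    Integrable.of_bound (hm t).aestronglyMeasurable _ (Eventually.of_forall (hb t))
  have hs : Summable fun t : ℕ => ∫ ω, ‖C.γ ^ t * C.reward π (ω t)‖ ∂(C.trajLaw π x) := by
    refine Summable.of_nonneg_of_le (fun t => integral_nonneg fun ω => norm_nonneg _)
      (fun t => ?_) ((summable_geometric_of_lt_one hC.γ_pos.le hC.γ_lt_one).mul_right R)
    calc _ ≤ ∫ _, C.γ ^ t * R ∂(C.trajLaw π x) :=
          integral_mono (hi t).norm (integrable_const _) (hb t)
      _ = _ := by simp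
  have := hasSum_integral_of_summable_integral_norm hi hs
  simpa only [integral_const_mul, value] using this

/-- Iterating `T_π` from any bounded function converges to the value of `π`. -/
lemma tendsto_bellman_iterate (hC : C.IsRegular) (π : Pol) {f : X → ℝ} (hf : BddMeasurable f)
    (x : X) : Tendsto (fun n => (C.bellman π)^[n] f x) atTop (𝓝 (C.value π x)) := by
  simp_rw [fun n => hC.bellman_iterate_eq_sum π x n hf]
  rw [← add_zero (C.value π x)]
  refine (hC.hasSum_value π x).tendsto_sum_nat.add ?_
  obtain ⟨hf, B, hB⟩ := hf
  refine squeeze_zero_norm (a := fun n => C.γ ^ n * B) (fun n => ?_) ?_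
  · rw [norm_mul, Real.norm_of_nonneg (pow_nonneg hC.γ_pos.le n)]
    refine mul_le_mul_of_nonneg_left ?_ (pow_nonneg hC.γ_pos.le n)
    have := norm_integral_le_of_norm_le_const (μ := C.trajLaw π x)
      (f := fun ω => f (ω n)) (C := B) (Eventually.of_forall fun ω => hB _)
    simpa using this
  · simpa using (tendsto_pow_atTop_nhds_zero_of_lt_one hC.γ_pos.le hC.γ_lt_one).mul_const B

/-- The value function of `π` is bounded and measurable, and it is a fixed point of `T_π`. -/
lemma bddMeasurable_value_and_fixed (hC : C.IsRegular) (π : Pol) :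
    BddMeasurable (C.value π) ∧ ∀ x, C.bellman π (C.value π) x = C.value π x := by
  obtain ⟨B, hB0, hB⟩ := hC.exists_bellman_invariant_bound
  have h0 : ∀ n x, |(C.bellman π)^[n] (fun _ => 0) x| ≤ B := by
    intro n
    induction n with
    | zero => simpa using fun _ => hB0
    | succ n ih =>
      rw [Function.iterate_succ_apply']
      exact hB π _ ih
  have hm : ∀ n, BddMeasurable ((C.bellman π)^[n] (fun _ => 0)) :=
    hC.bddMeasurable_bellman_iterate (BddMeasurable.const 0) π
  have ht := hC.tendsto_bellman_iterate π (BddMeasurable.const 0)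
  refine ⟨⟨measurable_of_tendsto_metrizable (fun n => (hm n).1) (tendsto_pi_nhds.2 ht), B,
    fun x => le_of_tendsto (ht x).abs (Eventually.of_forall fun n => h0 n x)⟩, fun x => ?_⟩
  have h1 := tendsto_bellman (C := C) (fun n => (hm n).1) h0 ht π x
  have h2 := (tendsto_add_atTop_iff_nat 1).2 (ht x)
  simp_rw [Function.iterate_succ_apply'] at h2
  exact tendsto_nhds_unique h1 h2

lemma bddMeasurable_value (hC : C.IsRegular) (π : Pol) : BddMeasurable (C.value π) :=
  (hC.bddMeasurable_value_and_fixed π).1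

lemma bellman_value (hC : C.IsRegular) (π : Pol) (x : X) :
    C.bellman π (C.value π) x = C.value π x :=
  (hC.bddMeasurable_value_and_fixed π).2 x

/-! ### The optimal value -/

lemma value_eq_of_fixed (hC : C.IsRegular) (π : Pol) {u : X → ℝ} (hu : BddMeasurable u)
    (h : ∀ x, C.bellman π u x = u x) (x : X) : C.value π x = u x := by
  have h1 : ∀ n, (C.bellman π)^[n] u = u := fun n => Function.iterate_fixed (funext h) n
  have h2 := hC.tendsto_bellman_iterate π hu x
  simp_rw [h1] at h2
  exact tendsto_nhds_unique h2 tendsto_const_nhds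

lemma value_le_of_bellman_le (hC : C.IsRegular) (π : Pol) {u : X → ℝ} (hu : BddMeasurable u)
    (h : ∀ x, C.bellman π u x ≤ u x) (x : X) : C.value π x ≤ u x := by
  have h1 : ∀ n x, (C.bellman π)^[n] u x ≤ u x := by
    intro n
    induction n with
    | zero => exact fun x => le_rfl
    | succ n ih =>
      intro x
      rw [Function.iterate_succ_apply']
      exact (hC.bellman_mono (hC.bddMeasurable_bellman_iterate hu π n) hu ih π x).trans (h x)
  exact le_of_tendsto (hC.tendsto_bellman_iterate π hu x) (Eventually.of_forall fun n => h1 n x)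

/-- Value iteration, started below all values, increases to a bounded measurable function that is
a fixed point of the Bellman operator of one of its greedy policies and is not increased by any
other one. -/
lemma exists_bellman_optimality (hC : C.IsRegular) :
    ∃ (u : X → ℝ) (π : Pol), BddMeasurable u ∧ (∀ x, C.bellman π u x = u x) ∧
      ∀ π' x, C.bellman π' u x ≤ u x := by
  obtain ⟨B, hB0, hB⟩ := hC.exists_bellman_invariant_bound
  have := hC.nonempty
  choose! G hG using hC.exists_greedy
  let u : ℕ → X → ℝ := fun n => (fun f => C.bellman (G f) f)^[n] (fun _ => -B)
  have hu : ∀ n, u (n + 1) = C.bellman (G (u n)) (u n) := fun n =>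
    Function.iterate_succ_apply' _ _ _
  have hm : ∀ n, BddMeasurable (u n) := by
    intro n
    induction n with
    | zero => exact BddMeasurable.const _
    | succ n ih => rw [hu]; exact hC.bddMeasurable_bellman ih _
  have hb : ∀ n x, |u n x| ≤ B := by
    intro n
    induction n with
    | zero => intro x; simp [u, abs_of_nonneg hB0]
    | succ n ih => rw [hu]; exact hB _ _ ih
  have hmono : ∀ n x, u n x ≤ u (n + 1) x := by
    intro n
    induction n with
    | zero => exact fun x => (abs_le.1 (hb 1 x)).1
    | succ n ih =>
      intro x
      rw [hu (n + 1)]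
      nth_rw 1 [hu n]
      exact (hC.bellman_mono (hm n) (hm (n + 1)) ih _ x).trans (hG _ (hm (n + 1)) _ x)
  have hbdd : ∀ x, BddAbove (Set.range fun n => u n x) := fun x =>
    ⟨B, by rintro _ ⟨n, rfl⟩; exact (abs_le.1 (hb n x)).2⟩
  let w : X → ℝ := fun x => ⨆ n, u n x
  have ht : ∀ x, Tendsto (fun n => u n x) atTop (𝓝 (w x)) := fun x =>
    tendsto_atTop_ciSup (monotone_nat_of_le_succ fun n => hmono n x) (hbdd x)
  have hle : ∀ n x, u n x ≤ w x := fun n x => le_ciSup (hbdd x) n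
  have hw : BddMeasurable w :=
    ⟨measurable_of_tendsto_metrizable (fun n => (hm n).1) (tendsto_pi_nhds.2 ht), B,
      fun x => le_of_tendsto (ht x).abs (Eventually.of_forall fun n => hb n x)⟩
  have hup : ∀ π' x, C.bellman π' w x ≤ w x := fun π' x =>
    le_of_tendsto (tendsto_bellman (C := C) (fun n => (hm n).1) hb ht π' x)
      (Eventually.of_forall fun n =>
        (hG _ (hm n) π' x).trans ((congrFun (hu n) x).ge.trans (hle (n + 1) x)))
  refine ⟨w, G w, hw, fun x => le_antisymm (hup _ x) ?_, hup⟩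
  refine le_of_tendsto ((tendsto_add_atTop_iff_nat 1).2 (ht x)) (Eventually.of_forall fun n => ?_)
  rw [hu]
  exact (hC.bellman_mono (hm n) hw (hle n) _ x).trans (hG _ hw _ x)

/-- There is an optimal policy `π`, and the optimal value solves the optimality equation
`v_* = T_π v_*`. -/
lemma exists_optimal (hC : C.IsRegular) :
    ∃ π : Pol, BddMeasurable C.optValue ∧ (∀ x, C.bellman π C.optValue x = C.optValue x) ∧
      ∀ π' x, C.value π' x ≤ C.optValue x := by
  obtain ⟨u, π, hu, hfix, hle⟩ := hC.exists_bellman_optimality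
  have := hC.nonempty
  have h1 : ∀ π' x, C.value π' x ≤ u x := fun π' => hC.value_le_of_bellman_le π' hu (hle π')
  have h2 : C.optValue = u := by
    funext x
    refine le_antisymm (ciSup_le fun π' => h1 π' x) ?_
    rw [← hC.value_eq_of_fixed π hu hfix x]
    exact le_ciSup (f := fun π' => C.value π' x)
      ⟨u x, by rintro _ ⟨π', rfl⟩; exact h1 π' x⟩ π
  exact ⟨π, h2 ▸ hu, h2 ▸ hfix, h2 ▸ h1⟩

end IsRegular

end ControlledChain

/-! ### Finite action spaces: measurable selection of maximizing actions -/

lemma exists_measurable_argmax {S A β : Type*} [MeasurableSpace S] [MeasurableSpace A] [Finite A]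
    [Nonempty A] [MeasurableSingletonClass A] [LinearOrder β] [TopologicalSpace β]
    [OrderClosedTopology β] [SecondCountableTopology β] [MeasurableSpace β]
    [OpensMeasurableSpace β] {g : S → A → β} (hg : ∀ a, Measurable fun s => g s a) :
    ∃ π : Policy S A, ∀ s a, g s a ≤ g s (π.1 s) := by
  classical
  have := Fintype.ofFinite A
  have hg' : Measurable (Function.uncurry g) := measurable_from_prod_countable_left hg
  have key : ∀ t : Finset A, t.Nonempty →
      ∃ π : S → A, Measurable π ∧ ∀ s, ∀ a ∈ t, g s a ≤ g s (π s) := by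
    intro t ht
    induction ht using Finset.Nonempty.cons_induction with
    | singleton a => exact ⟨fun _ => a, measurable_const, by simp⟩
    | cons a t ha ht ih =>
      obtain ⟨π, hπ, hmax⟩ := ih
      refine ⟨fun s => if g s (π s) ≤ g s a then a else π s, Measurable.ite
        (measurableSet_le (hg'.comp (measurable_id.prodMk hπ)) (hg a)) measurable_const hπ, ?_⟩
      intro s b hb
      rw [Finset.mem_cons] at hb
      by_cases h : g s (π s) ≤ g s a
      · simp only [h, if_true]
        rcases hb with rfl | hb
        · exact le_rfl
        · exact (hmax s b hb).trans h
      · simp only [h, if_false]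
        rcases hb with rfl | hb
        · exact (not_le.1 h).le
        · exact hmax s b hb
  obtain ⟨π, hπ, hmax⟩ := key Finset.univ Finset.univ_nonempty
  exact ⟨⟨π, hπ⟩, fun s a => hmax s a (Finset.mem_univ a)⟩

namespace MDP

open ControlledChain

variable {S A : Type*} [MeasurableSpace S] [MeasurableSpace A]

instance (M : MDP S A) : IsMarkovKernel M.P := M.markov

lemma bellman_onStateActions (M : MDP S A) (π : Policy S A) {Q : S × A → ℝ} (hQ : Measurable Q)
    (x : S × A) : M.onStateActions.bellman π Q x =
      M.r x.1 x.2 + M.γ * ∫ s, Q (s, π.1 s) ∂(M.P x) := by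
  have hm : Measurable fun s' => (s', π.1 s') := measurable_id.prodMk π.2
  simp only [bellman, onStateActions]
  rw [Kernel.map_apply _ hm, integral_map hm.aemeasurable hQ.aestronglyMeasurable]

lemma bddMeasurable_comp_policy {Q : S × A → ℝ} (hQ : BddMeasurable Q) (π : Policy S A) :
    BddMeasurable fun s => Q (s, π.1 s) := by
  obtain ⟨hQ, B, hB⟩ := hQ
  exact ⟨hQ.comp (measurable_id.prodMk π.2), B, fun s => hB _⟩

lemma bellman_onStateActions_le (M : MDP S A) {Q : S × A → ℝ} (hQ : BddMeasurable Q)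
    {π : Policy S A} (hπ : ∀ s a, Q (s, a) ≤ Q (s, π.1 s)) (π' : Policy S A) (x : S × A) :
    M.onStateActions.bellman π' Q x ≤ M.onStateActions.bellman π Q x := by
  rw [bellman_onStateActions M π' hQ.1, bellman_onStateActions M π hQ.1]
  have := integral_mono ((bddMeasurable_comp_policy hQ π').integrable (M.P x))
    ((bddMeasurable_comp_policy hQ π).integrable (M.P x)) (fun s => hπ s _)
  have := mul_le_mul_of_nonneg_left this M.γ_pos.le
  linarith

variable [Finite A] [Nonempty A] [MeasurableSingletonClass A]

lemma isRegular_onStates (M : MDP S A) : M.onStates.IsRegular where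
  γ_pos := M.γ_pos
  γ_lt_one := M.γ_lt_one
  measurable_reward π := M.measurable_r.comp (measurable_id.prodMk π.2)
  bounded_reward := by
    obtain ⟨R, hR⟩ := M.bounded_r
    exact ⟨R, fun π s => hR _ _⟩
  exists_greedy f hf := by
    have h1 : Measurable fun x : S × A => M.r x.1 x.2 + M.γ * ∫ y, f y ∂(M.P x) :=
      M.measurable_r.add (hf.1.stronglyMeasurable.integral_kernel.measurable.const_mul _)
    obtain ⟨π, hπ⟩ := exists_measurable_argmax
      (g := fun s a => M.r s a + M.γ * ∫ y, f y ∂(M.P (s, a)))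
      (fun a => h1.comp (measurable_id.prodMk measurable_const))
    exact ⟨π, fun π' s => hπ s _⟩
  exists_max_lintegral g hg := by
    obtain ⟨π, hπ⟩ := exists_measurable_argmax (g := fun s a => ∫⁻ y, g y ∂(M.P (s, a)))
      (fun a => hg.lintegral_kernel.comp (measurable_id.prodMk measurable_const))
    exact ⟨π, fun π' s => hπ s _⟩

lemma isRegular_onStateActions (M : MDP S A) : M.onStateActions.IsRegular where
  γ_pos := M.γ_pos
  γ_lt_one := M.γ_lt_one
  measurable_reward _ := M.measurable_r
  bounded_reward := by
    obtain ⟨R, hR⟩ := M.bounded_r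
    exact ⟨R, fun π s => hR _ _⟩
  exists_greedy Q hQ := by
    obtain ⟨π, hπ⟩ := exists_measurable_argmax (g := fun s a => Q (s, a))
      (fun a => hQ.1.comp (measurable_id.prodMk measurable_const))
    exact ⟨π, M.bellman_onStateActions_le hQ hπ⟩
  exists_max_lintegral g hg := by
    obtain ⟨π, hπ⟩ := exists_measurable_argmax (g := fun s a => g (s, a))
      (fun a => hg.comp (measurable_id.prodMk measurable_const))
    refine ⟨π, fun π' x => ?_⟩
    have hm : ∀ π : Policy S A, Measurable fun s' => (s', π.1 s') :=
      fun π => measurable_id.prodMk π.2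
    simp only [onStateActions]
    rw [Kernel.map_apply _ (hm π'), Kernel.map_apply _ (hm π), lintegral_map hg (hm π'),
      lintegral_map hg (hm π)]
    exact lintegral_mono fun s => hπ s _

end MDP

namespace ControlledChain

variable {Pol X : Type*} [MeasurableSpace X]

/-! ### The maximal discounted transition operator -/

/-- The operator `Γ g = γ · max_π P_π g` on nonnegative functions, where the maximum is taken at
each point. It dominates every `γ P_π` and is monotone and sublinear. -/
noncomputable def maxStep (C : ControlledChain Pol X) (g : X → ℝ≥0∞) (x : X) : ℝ≥0∞ :=
  ENNReal.ofReal C.γ * ⨆ π, ∫⁻ y, g y ∂(C.kernel π x)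

/-- The tail `∑_{j ≥ n} Γ^j g` of the Neumann series of `Γ`. -/
noncomputable def tail (C : ControlledChain Pol X) (n : ℕ) (g : X → ℝ≥0∞) (x : X) : ℝ≥0∞ :=
  ∑' j, C.maxStep^[n + j] g x

variable {C : ControlledChain Pol X}

lemma maxStep_mono : Monotone C.maxStep := fun f g h x => by
  unfold maxStep
  gcongr
  exact h _

lemma maxStep_iterate_mono (n : ℕ) : Monotone C.maxStep^[n] := maxStep_mono.iterate n

lemma maxStep_add_le {f : X → ℝ≥0∞} (hf : Measurable f) (g : X → ℝ≥0∞) :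
    C.maxStep (f + g) ≤ C.maxStep f + C.maxStep g := by
  intro x
  simp only [maxStep, Pi.add_apply]
  rw [← mul_add]
  gcongr
  refine iSup_le fun π => ?_
  rw [lintegral_add_left hf]
  exact add_le_add (le_iSup (fun π => ∫⁻ y, f y ∂(C.kernel π x)) π)
    (le_iSup (fun π => ∫⁻ y, g y ∂(C.kernel π x)) π)

lemma maxStep_zero : C.maxStep 0 = 0 := by
  funext x
  simp [maxStep]

lemma maxStep_iterate_zero (n : ℕ) : C.maxStep^[n] 0 = 0 :=
  Function.iterate_fixed maxStep_zero n

lemma tail_mono (n : ℕ) : Monotone (C.tail n) := fun _ _ h x => by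
  refine ENNReal.tsum_le_tsum fun j => ?_
  exact maxStep_iterate_mono (n + j) h x

lemma tail_zero (n : ℕ) : C.tail n 0 = 0 := by
  funext x
  simp [tail, maxStep_iterate_zero]

lemma sum_add_tail (n m : ℕ) (g : X → ℝ≥0∞) (x : X) :
    ∑ j ∈ Finset.range m, C.maxStep^[n + j] g x + C.tail (n + m) g x = C.tail n g x := by
  have := Summable.sum_add_tsum_nat_add' (f := fun j => C.maxStep^[n + j] g x) (k := m)
    ENNReal.summable
  rw [tail, tail, ← this]
  congr 2
  funext j
  rw [add_assoc, add_comm m j]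

lemma iterate_add_tail (n : ℕ) (g : X → ℝ≥0∞) (x : X) :
    C.maxStep^[n] g x + C.tail (n + 1) g x = C.tail n g x := by
  simpa using sum_add_tail (C := C) n 1 g x

lemma tail_iterate (n m : ℕ) (g : X → ℝ≥0∞) :
    C.tail n (C.maxStep^[m] g) = C.tail (n + m) g := by
  funext x
  refine tsum_congr fun j => ?_
  rw [← Function.iterate_add_apply, add_right_comm]

lemma maxStep_le_of_le_const {g : X → ℝ≥0∞} {B : ℝ≥0∞} (h : ∀ x, g x ≤ B) (x : X) :
    C.maxStep g x ≤ ENNReal.ofReal C.γ * B := by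
  unfold maxStep
  gcongr
  refine iSup_le fun π => (lintegral_mono h).trans ?_
  simp

lemma maxStep_iterate_le_of_le_const {g : X → ℝ≥0∞} {B : ℝ≥0∞} (h : ∀ x, g x ≤ B) (n : ℕ) :
    ∀ x, C.maxStep^[n] g x ≤ ENNReal.ofReal C.γ ^ n * B := by
  induction n with
  | zero => simpa using h
  | succ n ih =>
    intro x
    rw [Function.iterate_succ_apply', pow_succ', mul_assoc]
    exact maxStep_le_of_le_const ih x

namespace IsRegular

lemma exists_maxStep_eq (hC : C.IsRegular) {g : X → ℝ≥0∞} (hg : Measurable g) :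
    ∃ π, ∀ x, C.maxStep g x = ENNReal.ofReal C.γ * ∫⁻ y, g y ∂(C.kernel π x) := by
  obtain ⟨π, hπ⟩ := hC.exists_max_lintegral g hg
  refine ⟨π, fun x => ?_⟩
  unfold maxStep
  rw [le_antisymm (iSup_le fun π' => hπ π' x)
    (le_iSup (fun π => ∫⁻ y, g y ∂(C.kernel π x)) π)]

lemma measurable_maxStep (hC : C.IsRegular) {g : X → ℝ≥0∞} (hg : Measurable g) :
    Measurable (C.maxStep g) := by
  obtain ⟨π, hπ⟩ := hC.exists_maxStep_eq hg
  rw [funext hπ]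
  exact hg.lintegral_kernel.const_mul _

lemma measurable_maxStep_iterate (hC : C.IsRegular) {g : X → ℝ≥0∞} (hg : Measurable g) (n : ℕ) :
    Measurable (C.maxStep^[n] g) := by
  induction n with
  | zero => exact hg
  | succ n ih =>
    rw [Function.iterate_succ_apply']
    exact hC.measurable_maxStep ih

lemma measurable_tail (hC : C.IsRegular) {g : X → ℝ≥0∞} (hg : Measurable g) (n : ℕ) :
    Measurable (C.tail n g) :=
  Measurable.tsum fun _ => hC.measurable_maxStep_iterate hg _

lemma iterate_add_le (hC : C.IsRegular) {f : X → ℝ≥0∞} (hf : Measurable f) (g : X → ℝ≥0∞)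
    (n : ℕ) : C.maxStep^[n] (f + g) ≤ C.maxStep^[n] f + C.maxStep^[n] g := by
  induction n with
  | zero => exact le_rfl
  | succ n ih =>
    simp only [Function.iterate_succ_apply']
    exact (maxStep_mono ih).trans (maxStep_add_le (hC.measurable_maxStep_iterate hf n) _)

lemma iterate_sum_le (hC : C.IsRegular) {f : ℕ → X → ℝ≥0∞} (hf : ∀ j, Measurable (f j))
    (n m : ℕ) : C.maxStep^[n] (∑ j ∈ Finset.range m, f j) ≤
      ∑ j ∈ Finset.range m, C.maxStep^[n] (f j) := by
  induction m with
  | zero => simp [maxStep_iterate_zero]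
  | succ m ih =>
    rw [Finset.sum_range_succ, Finset.sum_range_succ]
    have hm : Measurable (∑ j ∈ Finset.range m, f j) :=
      Finset.sum_induction _ Measurable (fun _ _ => Measurable.add) measurable_zero
        fun j _ => hf j
    exact (hC.iterate_add_le hm _ n).trans (add_le_add_left ih _)

lemma tail_add_le (hC : C.IsRegular) {f : X → ℝ≥0∞} (hf : Measurable f) (g : X → ℝ≥0∞)
    (n : ℕ) : C.tail n (f + g) ≤ C.tail n f + C.tail n g := by
  intro x
  simp only [tail, Pi.add_apply]
  rw [← ENNReal.tsum_add]
  exact ENNReal.tsum_le_tsum fun j => hC.iterate_add_le hf g _ x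

/-- A bounded function with `δ ≤ Γ δ + h` is at most `∑_j Γ^j h`; here with `Γ^n` applied to both
sides. -/
lemma iterate_le_tail_of_le (hC : C.IsRegular) {δ h : X → ℝ≥0∞} (hδ : Measurable δ)
    {B : ℝ≥0∞} (hB : B ≠ ∞) (hδB : ∀ x, δ x ≤ B) (hle : δ ≤ C.maxStep δ + h) (n : ℕ) :
    C.maxStep^[n] δ ≤ C.tail n h := by
  intro x
  have hstep : ∀ i, C.maxStep^[i] δ x ≤ C.maxStep^[i + 1] δ x + C.maxStep^[i] h x := by
    intro i
    rw [Function.iterate_succ_apply]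
    exact (maxStep_iterate_mono i hle x).trans
      (hC.iterate_add_le (hC.measurable_maxStep hδ) h i x)
  have hN : ∀ N, C.maxStep^[n] δ x ≤
      C.maxStep^[n + N] δ x + ∑ j ∈ Finset.range N, C.maxStep^[n + j] h x := by
    intro N
    induction N with
    | zero => simp
    | succ N ih =>
      rw [Finset.sum_range_succ, ← add_assoc n N 1]
      calc _ ≤ _ := ih
        _ ≤ _ := add_le_add_left (hstep (n + N)) _
        _ = _ := by ring
  have hlim : Tendsto (fun N => ENNReal.ofReal C.γ ^ (n + N) * B + C.tail n h x) atTop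
      (𝓝 (0 * B + C.tail n h x)) := by
    refine Tendsto.add (ENNReal.Tendsto.mul_const ?_ (Or.inr hB)) tendsto_const_nhds
    have h1 := ENNReal.tendsto_pow_atTop_nhds_zero_of_lt_one
      (ENNReal.ofReal_lt_one.2 hC.γ_lt_one)
    simpa [add_comm] using (tendsto_add_atTop_iff_nat n).2 h1
  rw [zero_mul, zero_add] at hlim
  refine ge_of_tendsto hlim (Eventually.of_forall fun N => (hN N).trans ?_)
  exact add_le_add (maxStep_iterate_le_of_le_const hδB _ x) (ENNReal.sum_le_tsum _)

end IsRegular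

/-! ### Positive parts of differences of Bellman updates -/

/-- The positive part of a real function, with values in `ℝ≥0∞`. -/
noncomputable def pos (f : X → ℝ) (x : X) : ℝ≥0∞ := ENNReal.ofReal (f x)

lemma measurable_pos {f : X → ℝ} (hf : Measurable f) : Measurable (pos f) := hf.ennreal_ofReal

lemma pos_mono {Y : Type*} {f g : Y → ℝ} (h : ∀ x, f x ≤ g x) : pos f ≤ pos g := fun x =>
  ENNReal.ofReal_le_ofReal (h x)

lemma BddMeasurable.exists_pos_le {f : X → ℝ} (hf : BddMeasurable f) :
    ∃ B : ℝ≥0∞, B ≠ ∞ ∧ ∀ x, pos f x ≤ B := by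
  obtain ⟨-, B, hB⟩ := hf
  exact ⟨ENNReal.ofReal B, ENNReal.ofReal_ne_top, fun x =>
    ENNReal.ofReal_le_ofReal ((le_abs_self _).trans (hB x))⟩

lemma ofReal_integral_le_lintegral_pos (f : X → ℝ) (μ : Measure X) :
    ENNReal.ofReal (∫ x, f x ∂μ) ≤ ∫⁻ x, pos f x ∂μ := by
  by_cases hf : Integrable f μ
  · rw [integral_eq_lintegral_pos_part_sub_lintegral_neg_part hf]
    refine (ENNReal.ofReal_le_ofReal (sub_le_self _ ENNReal.toReal_nonneg)).trans ?_
    exact ENNReal.ofReal_toReal_le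
  · simp [integral_undef hf]

lemma pos_bellman_sub_le (hC : C.IsRegular) {f g : X → ℝ} (hf : BddMeasurable f)
    (hg : BddMeasurable g) (π : Pol) :
    pos (fun x => C.bellman π f x - C.bellman π g x) ≤
      C.maxStep (pos fun x => f x - g x) := by
  intro x
  have h1 : C.bellman π f x - C.bellman π g x = C.γ * ∫ y, (f y - g y) ∂(C.kernel π x) := by
    unfold bellman
    rw [integral_sub (hf.integrable _) (hg.integrable _)]
    ring
  rw [pos, h1, ENNReal.ofReal_mul hC.γ_pos.le]
  unfold maxStep
  gcongr
  exact (ofReal_integral_le_lintegral_pos _ _).trans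
    (le_iSup (fun π => ∫⁻ y, pos (fun x => f x - g x) y ∂(C.kernel π x)) π)

lemma pos_bellman_iterate_sub_le (hC : C.IsRegular) {f g : X → ℝ} (hf : BddMeasurable f)
    (hg : BddMeasurable g) (π : Pol) (n : ℕ) :
    pos (fun x => (C.bellman π)^[n] f x - (C.bellman π)^[n] g x) ≤
      C.maxStep^[n] (pos fun x => f x - g x) := by
  induction n with
  | zero => exact le_rfl
  | succ n ih =>
    simp only [Function.iterate_succ_apply']
    exact (pos_bellman_sub_le hC (hC.bddMeasurable_bellman_iterate hf π n)
      (hC.bddMeasurable_bellman_iterate hg π n) π).trans (maxStep_mono ih)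

/-- Telescoping of `T_π f - T_π^{n+1} f` along the powers of `T_π`. -/
lemma pos_bellman_sub_iterate_le (hC : C.IsRegular) {f : X → ℝ} (hf : BddMeasurable f)
    (π : Pol) (n : ℕ) :
    pos (fun x => C.bellman π f x - (C.bellman π)^[n + 1] f x) ≤
      ∑ j ∈ Finset.range n, C.maxStep^[j + 1] (pos fun x => f x - C.bellman π f x) := by
  induction n with
  | zero => intro x; simp [pos]
  | succ n ih =>
    intro x
    rw [Finset.sum_range_succ, Pi.add_apply]
    have h1 := pos_bellman_iterate_sub_le hC hf (hC.bddMeasurable_bellman hf π) π (n + 1) x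
    have h2 : C.bellman π f x - (C.bellman π)^[n + 1 + 1] f x =
        (C.bellman π f x - (C.bellman π)^[n + 1] f x) +
          ((C.bellman π)^[n + 1] f x - (C.bellman π)^[n + 1] (C.bellman π f) x) := by
      rw [Function.iterate_succ_apply _ (n + 1)]
      ring
    rw [pos, h2]
    exact ENNReal.ofReal_add_le.trans (add_le_add (ih x) h1)

end ControlledChain

namespace ControlledChain

variable {Pol X : Type*} [MeasurableSpace X] {C : ControlledChain Pol X}

/-! ### Pointwise error propagation -/

lemma pos_le_enorm {Y : Type*} (f : Y → ℝ) : pos f ≤ fun x => ‖f x‖ₑ := fun x =>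
  Real.ofReal_le_enorm (f x)

lemma pos_neg_le_enorm {Y : Type*} (f : Y → ℝ) : pos (fun x => -f x) ≤ fun x => ‖f x‖ₑ :=
  fun x => by
    simpa only [enorm_neg, pos] using Real.ofReal_le_enorm (-f x)

lemma EvalStep.bddMeasurable (hC : C.IsRegular) {m : ℕ} {v ε : ℕ → X → ℝ} {π : ℕ → Pol}
    (h : C.EvalStep m v ε π) (k : ℕ) : BddMeasurable (v k) := by
  induction k with
  | zero => exact h.init
  | succ k ih =>
    rw [funext (h.eval k)]
    exact (hC.bddMeasurable_bellman_iterate ih _ m).add (h.err k)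

/-- The Bellman residual of the greedy policy, `v_k - T_{π_{k+1}} v_k`. -/
noncomputable def residual (C : ControlledChain Pol X) (v : ℕ → X → ℝ) (π : ℕ → Pol) (k : ℕ)
    (x : X) : ℝ := v k x - C.bellman (π (k + 1)) (v k) x

/-- The distance to the optimal value, `v_* - v_k`. -/
noncomputable def gap (C : ControlledChain Pol X) (v : ℕ → X → ℝ) (k : ℕ) (x : X) : ℝ :=
  C.optValue x - v k x

section AMPI

variable {m : ℕ} {v ε ε' : ℕ → X → ℝ} {π : ℕ → Pol}

lemma IsAMPI.bddMeasurable_residual (hC : C.IsRegular) (h : C.IsAMPI m v ε ε' π) (k : ℕ) :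
    BddMeasurable (C.residual v π k) :=
  (h.bddMeasurable hC k).sub (hC.bddMeasurable_bellman (h.bddMeasurable hC k) _)

lemma IsAMPI.bddMeasurable_gap (hC : C.IsRegular) (h : C.IsAMPI m v ε ε' π) (k : ℕ) :
    BddMeasurable (C.gap v k) :=
  hC.exists_optimal.choose_spec.1.sub (h.bddMeasurable hC k)

/-- The residual contracts under the `m` evaluation steps, up to the errors of the step. -/
lemma IsAMPI.pos_residual_succ_le (hC : C.IsRegular) (h : C.IsAMPI m v ε ε' π) (k : ℕ) :
    pos (C.residual v π (k + 1)) ≤ C.maxStep^[m] (pos (C.residual v π k)) +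
      C.maxStep (fun x => ‖ε (k + 1) x‖ₑ) + (fun x => ‖ε (k + 1) x‖ₑ) +
        pos (ε' (k + 1 + 1)) := by
  intro x
  have hv := h.bddMeasurable hC
  have hT := hC.bddMeasurable_bellman_iterate (hv k) (π (k + 1)) m
  have h1 := pos_bellman_iterate_sub_le hC (hv k)
    (hC.bddMeasurable_bellman (hv k) (π (k + 1))) (π (k + 1)) m x
  have h2 := pos_bellman_sub_le hC hT (hv (k + 1)) (π (k + 1)) x
  have h3 : pos (fun x => (C.bellman (π (k + 1)))^[m] (v k) x - v (k + 1) x) ≤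
      fun x => ‖ε (k + 1) x‖ₑ := by
    refine le_trans (pos_mono fun y => ?_) (pos_neg_le_enorm (ε (k + 1)))
    rw [h.eval k y]
    linarith
  have hle : C.residual v π (k + 1) x ≤
      ((C.bellman (π (k + 1)))^[m] (v k) x -
        (C.bellman (π (k + 1)))^[m] (C.bellman (π (k + 1)) (v k)) x) +
      (C.bellman (π (k + 1)) ((C.bellman (π (k + 1)))^[m] (v k)) x -
        C.bellman (π (k + 1)) (v (k + 1)) x) + ε (k + 1) x + ε' (k + 1 + 1) x := by
    have hg := h.greedy (k + 1) (π (k + 1)) x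
    rw [← Function.iterate_succ_apply, Function.iterate_succ_apply']
    unfold residual
    have he := h.eval k x
    linarith
  simp only [Pi.add_apply]
  refine (ENNReal.ofReal_le_ofReal hle).trans ?_
  refine ENNReal.ofReal_add_le.trans (add_le_add ?_ le_rfl)
  refine ENNReal.ofReal_add_le.trans (add_le_add ?_ (Real.ofReal_le_enorm _))
  exact ENNReal.ofReal_add_le.trans (add_le_add h1 (h2.trans (maxStep_mono h3 x)))

lemma IsAMPI.pos_optValue_sub_bellman_le (hC : C.IsRegular) (h : C.IsAMPI m v ε ε' π) (k : ℕ) :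
    pos (fun x => C.optValue x - C.bellman (π (k + 1)) (v k) x) ≤
      C.maxStep (pos (C.gap v k)) + pos (ε' (k + 1)) := by
  intro x
  obtain ⟨πs, hb, hfix, -⟩ := hC.exists_optimal
  have h1 := pos_bellman_sub_le hC hb (h.bddMeasurable hC k) πs x
  have hg := h.greedy k πs x
  have hle : C.optValue x - C.bellman (π (k + 1)) (v k) x ≤
      (C.bellman πs C.optValue x - C.bellman πs (v k) x) + ε' (k + 1) x := by
    rw [hfix]
    linarith
  exact (ENNReal.ofReal_le_ofReal hle).trans
    (ENNReal.ofReal_add_le.trans (add_le_add h1 le_rfl))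

lemma IsAMPI.pos_gap_succ_le (hC : C.IsRegular) {n : ℕ} (h : C.IsAMPI (n + 1) v ε ε' π) (k : ℕ) :
    pos (C.gap v (k + 1)) ≤ C.maxStep (pos (C.gap v k)) + pos (ε' (k + 1)) +
      ∑ j ∈ Finset.range n, C.maxStep^[j + 1] (pos (C.residual v π k)) +
        fun x => ‖ε (k + 1) x‖ₑ := by
  intro x
  have h1 := h.pos_optValue_sub_bellman_le hC k x
  have h2 := pos_bellman_sub_iterate_le hC (h.bddMeasurable hC k) (π (k + 1)) n x
  have h3 : C.gap v (k + 1) x = (C.optValue x - C.bellman (π (k + 1)) (v k) x) +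
      (C.bellman (π (k + 1)) (v k) x - (C.bellman (π (k + 1)))^[n + 1] (v k) x) +
        -ε (k + 1) x := by
    rw [gap, h.eval k x]
    ring
  simp only [Pi.add_apply] at h1 ⊢
  rw [pos, h3]
  refine ENNReal.ofReal_add_le.trans (add_le_add ?_ (pos_neg_le_enorm _ x))
  exact ENNReal.ofReal_add_le.trans (add_le_add h1 h2)

lemma IsAMPI.pos_loss_le (hC : C.IsRegular) (h : C.IsAMPI m v ε ε' π) (k : ℕ) :
    pos (fun x => C.optValue x - C.value (π (k + 1)) x) ≤
      C.maxStep (pos (C.gap v k)) + pos (ε' (k + 1)) + C.tail 1 (pos (C.residual v π k)) := by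
  intro x
  have hv := h.bddMeasurable hC k
  have hval := hC.bddMeasurable_value (π (k + 1))
  have h1 := h.pos_optValue_sub_bellman_le hC k x
  have h2 := pos_bellman_sub_le hC hv hval (π (k + 1))
  obtain ⟨B, hB, hBle⟩ := (hv.sub hval).exists_pos_le
  -- with `π = π_{k+1}` and `b_k` the residual, `v_k - v_π = b_k + γ P_π (v_k - v_π)`
  have h3 : pos (fun x => v k x - C.value (π (k + 1)) x) ≤
      C.maxStep (pos fun x => v k x - C.value (π (k + 1)) x) + pos (C.residual v π k) := by
    intro y
    refine le_trans ?_ (add_le_add (h2 y) le_rfl)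
    refine le_trans (ENNReal.ofReal_le_ofReal ?_) ENNReal.ofReal_add_le
    simp only [hC.bellman_value, residual]
    linarith
  have h4 := hC.iterate_le_tail_of_le (measurable_pos (hv.sub hval).1) hB hBle h3 1 x
  have h5 : C.optValue x - C.value (π (k + 1)) x =
      (C.optValue x - C.bellman (π (k + 1)) (v k) x) +
        (C.bellman (π (k + 1)) (v k) x - C.bellman (π (k + 1)) (C.value (π (k + 1))) x) := by
    rw [hC.bellman_value]
    ring
  rw [pos, h5]
  exact ENNReal.ofReal_add_le.trans (add_le_add h1 ((h2 x).trans h4))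

/-- The quantity that controls the loss,
`Γ^{n+1} (v_* - v_k)⁺ + ∑_{j ≥ n+1} Γ^j (b_k)⁺ + Γ^n ε'_{k+1}` with `b_k` the residual. Going back
one iteration raises `n` by one, independently of `m`. -/
noncomputable def potential (C : ControlledChain Pol X) (v ε' : ℕ → X → ℝ) (π : ℕ → Pol)
    (k n : ℕ) (x : X) : ℝ≥0∞ :=
  C.maxStep^[n + 1] (pos (C.gap v k)) x + C.tail (n + 1) (pos (C.residual v π k)) x +
    C.maxStep^[n] (pos (ε' (k + 1))) x

lemma IsAMPI.potential_succ_le (hC : C.IsRegular) (hm : 1 ≤ m) (h : C.IsAMPI m v ε ε' π)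
    (k n : ℕ) (x : X) : C.potential v ε' π (k + 1) n x ≤ C.potential v ε' π k (n + 1) x +
      2 * C.tail (n + 1) (fun x => ‖ε (k + 1) x‖ₑ) x + C.tail n (pos (ε' (k + 1 + 1))) x := by
  obtain ⟨m, rfl⟩ := Nat.exists_eq_add_of_le' hm
  have hmε' : ∀ k, Measurable (pos (ε' (k + 1))) := fun k => measurable_pos (h.greedyErr k)
  have hmζ : Measurable fun x => ‖ε (k + 1) x‖ₑ := (h.err k).1.enorm
  have hmδ := measurable_pos (h.bddMeasurable_gap hC k).1
  have hmβ := measurable_pos (h.bddMeasurable_residual hC k).1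
  have hΓ := fun {g : X → ℝ≥0∞} => hC.measurable_maxStep_iterate (g := g)
  have hsum : Measurable
      (∑ j ∈ Finset.range m, C.maxStep^[j + 1] (pos (C.residual v π k))) :=
    Finset.sum_induction _ Measurable (fun _ _ => Measurable.add) measurable_zero
      fun j _ => hΓ hmβ _
  have hδ : C.maxStep^[n + 1] (pos (C.gap v (k + 1))) x ≤
      C.maxStep^[n + 1 + 1] (pos (C.gap v k)) x + C.maxStep^[n + 1] (pos (ε' (k + 1))) x +
        ∑ j ∈ Finset.range m, C.maxStep^[n + 1 + 1 + j] (pos (C.residual v π k)) x +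
          C.maxStep^[n + 1] (fun x => ‖ε (k + 1) x‖ₑ) x := by
    refine (maxStep_iterate_mono (n + 1) (h.pos_gap_succ_le hC k) x).trans ?_
    refine (hC.iterate_add_le (((hΓ hmδ 1).add (hmε' k)).add hsum) _ _ x).trans ?_
    refine add_le_add ?_ le_rfl
    refine (hC.iterate_add_le ((hΓ hmδ 1).add (hmε' k)) _ _ x).trans ?_
    refine add_le_add ?_ ?_
    · refine (hC.iterate_add_le (hΓ hmδ 1) _ _ x).trans (add_le_add ?_ le_rfl)
      rw [Function.iterate_succ_apply C.maxStep (n + 1)]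
      exact le_rfl
    · refine (hC.iterate_sum_le (fun j => hΓ hmβ (j + 1)) (n + 1) m x).trans ?_
      rw [Finset.sum_apply]
      refine Finset.sum_le_sum fun j _ => ?_
      rw [← Function.iterate_add_apply, show n + 1 + (j + 1) = n + 1 + 1 + j by ring]
  have hβ : C.tail (n + 1) (pos (C.residual v π (k + 1))) x ≤
      C.tail (n + 1 + 1 + m) (pos (C.residual v π k)) x +
        C.tail (n + 1 + 1) (fun x => ‖ε (k + 1) x‖ₑ) x +
          C.tail (n + 1) (fun x => ‖ε (k + 1) x‖ₑ) x +
            C.tail (n + 1) (pos (ε' (k + 1 + 1))) x := by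
    refine (tail_mono (n + 1) (h.pos_residual_succ_le hC k) x).trans ?_
    refine (hC.tail_add_le (((hΓ hmβ (m + 1)).add (hΓ hmζ 1)).add hmζ) _ _ x).trans ?_
    refine add_le_add ?_ le_rfl
    refine (hC.tail_add_le ((hΓ hmβ (m + 1)).add (hΓ hmζ 1)) _ _ x).trans ?_
    refine add_le_add ?_ le_rfl
    refine (hC.tail_add_le (hΓ hmβ (m + 1)) _ _ x).trans ?_
    have h1 := tail_iterate (C := C) (n + 1) 1 (fun x => ‖ε (k + 1) x‖ₑ)
    rw [Function.iterate_one] at h1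
    rw [Function.iterate_one, Pi.add_apply, h1, tail_iterate,
      show n + 1 + (m + 1) = n + 1 + 1 + m by ring]
  unfold potential
  rw [← sum_add_tail (n + 1 + 1) m (pos (C.residual v π k)) x, two_mul,
    ← iterate_add_tail n (pos (ε' (k + 1 + 1))) x]
  nth_rw 1 [← iterate_add_tail (n + 1) (fun x => ‖ε (k + 1) x‖ₑ) x]
  refine (add_le_add (add_le_add hδ hβ) le_rfl).trans (le_of_eq ?_)
  ring

/-- Unrolling the recursion of the potential down to the initial value. -/
lemma IsAMPI.potential_le (hC : C.IsRegular) (hm : 1 ≤ m) (h : C.IsAMPI m v ε ε' π)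
    {D : X → ℝ≥0∞} (hD : ∀ n x, C.potential v ε' π 0 n x ≤
      2 * C.tail (n + 1) D x + C.tail n (pos (ε' 1)) x) (k : ℕ) : ∀ (n : ℕ) (x : X),
    C.potential v ε' π k n x ≤ 2 * C.tail (n + k + 1) D x +
      2 * ∑ i ∈ Finset.range k, C.tail (n + i + 1) (fun x => ‖ε (k - i) x‖ₑ) x +
        ∑ i ∈ Finset.range (k + 1), C.tail (n + i) (pos (ε' (k + 1 - i))) x := by
  induction k with
  | zero => simpa using hD
  | succ k ih =>
    intro n x
    refine (h.potential_succ_le hC hm k n x).trans ?_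
    refine (add_le_add (add_le_add (ih (n + 1) x) le_rfl) le_rfl).trans (le_of_eq ?_)
    rw [Finset.sum_range_succ' (fun i => C.tail (n + i + 1) (fun x => ‖ε (k + 1 - i) x‖ₑ) x) k,
      Finset.sum_range_succ' (fun i => C.tail (n + i) (pos (ε' (k + 1 + 1 - i))) x) (k + 1)]
    have e : ∀ i, n + 1 + i = n + (i + 1) := fun i => by ring
    simp only [Nat.add_sub_add_right, Nat.sub_zero, add_zero, mul_add, e]
    ring

/-- The initial potential in terms of `v_* - v_0`. -/
lemma IsAMPI.potential_zero_le_gap (hC : C.IsRegular) (h : C.IsAMPI m v ε ε' π) (n : ℕ) (x : X) :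
    C.potential v ε' π 0 n x ≤
      2 * C.tail (n + 1) (fun x => ‖C.gap v 0 x‖ₑ) x + C.tail n (pos (ε' 1)) x := by
  have hmε' : Measurable (pos (ε' 1)) := measurable_pos (h.greedyErr 0)
  have hmg : Measurable fun x => ‖C.gap v 0 x‖ₑ := (h.bddMeasurable_gap hC 0).1.enorm
  have h1 : pos (C.residual v π 0) ≤
      (fun x => ‖C.gap v 0 x‖ₑ) + C.maxStep (fun x => ‖C.gap v 0 x‖ₑ) + pos (ε' 1) := by
    intro y
    obtain ⟨πs, hb, hfix, -⟩ := hC.exists_optimal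
    have h2 := pos_bellman_sub_le hC hb (h.bddMeasurable hC 0) πs y
    have hg := h.greedy 0 πs y
    have hle : C.residual v π 0 y ≤ -C.gap v 0 y +
        (C.bellman πs C.optValue y - C.bellman πs (v 0) y) + ε' 1 y := by
      rw [hfix, residual, gap]
      linarith
    refine (ENNReal.ofReal_le_ofReal hle).trans
      (ENNReal.ofReal_add_le.trans (add_le_add ?_ le_rfl))
    exact ENNReal.ofReal_add_le.trans (add_le_add (pos_neg_le_enorm _ y)
      (h2.trans (maxStep_mono (pos_le_enorm _) y)))
  have h3 : C.tail (n + 1) (pos (C.residual v π 0)) x ≤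
      C.tail (n + 1) (fun x => ‖C.gap v 0 x‖ₑ) x +
        C.tail (n + 1 + 1) (fun x => ‖C.gap v 0 x‖ₑ) x + C.tail (n + 1) (pos (ε' 1)) x := by
    refine (tail_mono (n + 1) h1 x).trans ?_
    refine (hC.tail_add_le (hmg.add (hC.measurable_maxStep hmg)) _ _ x).trans ?_
    refine add_le_add ((hC.tail_add_le hmg _ _ x).trans ?_) le_rfl
    have h4 := tail_iterate (C := C) (n + 1) 1 (fun x => ‖C.gap v 0 x‖ₑ)
    rw [Function.iterate_one] at h4
    rw [Pi.add_apply, h4]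
  have h5 := maxStep_iterate_mono (C := C) (n + 1) (pos_le_enorm (C.gap v 0)) x
  unfold potential
  rw [two_mul, ← iterate_add_tail n (pos (ε' 1)) x]
  nth_rw 1 [← iterate_add_tail (n + 1) (fun x => ‖C.gap v 0 x‖ₑ) x]
  refine (add_le_add (add_le_add h5 h3) le_rfl).trans (le_of_eq ?_)
  ring

/-- The initial potential in terms of the residual `v_0 - T_{π_1} v_0`. -/
lemma IsAMPI.potential_zero_le_residual (hC : C.IsRegular) (h : C.IsAMPI m v ε ε' π) (n : ℕ)
    (x : X) : C.potential v ε' π 0 n x ≤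
      2 * C.tail (n + 1) (fun x => ‖C.residual v π 0 x‖ₑ) x + C.tail n (pos (ε' 1)) x := by
  have hmε' : Measurable (pos (ε' 1)) := measurable_pos (h.greedyErr 0)
  have hmb : Measurable fun x => ‖C.residual v π 0 x‖ₑ :=
    (h.bddMeasurable_residual hC 0).1.enorm
  have hgap := h.bddMeasurable_gap hC 0
  -- `v_* - v_0 = (v_* - T_{π_1} v_0) - b_0`, and the first difference is bounded by the gap itself
  have h1 : pos (C.gap v 0) ≤ C.maxStep (pos (C.gap v 0)) +
      ((fun x => ‖C.residual v π 0 x‖ₑ) + pos (ε' 1)) := by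
    intro y
    have h2 := h.pos_optValue_sub_bellman_le hC 0 y
    have heq : C.gap v 0 y = (C.optValue y - C.bellman (π (0 + 1)) (v 0) y) +
        -C.residual v π 0 y := by
      rw [gap, residual]
      ring
    rw [pos, heq]
    refine (ENNReal.ofReal_add_le.trans (add_le_add h2 (pos_neg_le_enorm _ y))).trans
      (le_of_eq ?_)
    simp only [Pi.add_apply]
    ring
  obtain ⟨B, hB, hBle⟩ := hgap.exists_pos_le
  have h3 := (hC.iterate_le_tail_of_le (measurable_pos hgap.1) hB hBle h1 (n + 1) x).trans
    (hC.tail_add_le hmb _ _ x)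
  have h4 := tail_mono (C := C) (n + 1) (pos_le_enorm (C.residual v π 0)) x
  unfold potential
  rw [two_mul, ← iterate_add_tail n (pos (ε' 1)) x]
  refine (add_le_add (add_le_add h3 h4) le_rfl).trans (le_of_eq ?_)
  simp only [Pi.add_apply]
  ring

/-- The pointwise bound on the loss. The function `D` stands for `|v_* - v_0|` or for
`|v_0 - T_{π_1} v_0|`. -/
lemma IsAMPI.loss_le (hC : C.IsRegular) (hm : 1 ≤ m) (h : C.IsAMPI m v ε ε' π)
    {D : X → ℝ≥0∞} (hD : ∀ n x, C.potential v ε' π 0 n x ≤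
      2 * C.tail (n + 1) D x + C.tail n (pos (ε' 1)) x) (k : ℕ) (x : X) :
    ‖C.optValue x - C.value (π (k + 1)) x‖ₑ ≤ 2 * C.tail (k + 1) D x +
      2 * ∑ i ∈ Finset.range k, C.tail (i + 1) (fun x => ‖ε (k - i) x‖ₑ) x +
        ∑ i ∈ Finset.range (k + 1), C.tail i (pos (ε' (k + 1 - i))) x := by
  obtain ⟨-, -, -, hle⟩ := hC.exists_optimal
  have h1 := h.pos_loss_le hC k x
  have h2 := h.potential_le hC hm hD k 0 x
  rw [Real.enorm_of_nonneg (sub_nonneg.2 (hle _ x))]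
  simp only [zero_add] at h2
  refine (h1.trans (le_of_eq ?_)).trans h2
  simp only [Pi.add_apply, potential, zero_add, Function.iterate_one, Function.iterate_zero, id]
  ring

end AMPI

end ControlledChain

/-! ### `L^p` estimates for `ℝ≥0∞`-valued functions -/

section LpEstimates

variable {X : Type*} [MeasurableSpace X]

lemma lintegral_mul_le_eLpNorm_mul_eLpNorm {μ : Measure X} {q q' : ℝ≥0∞}
    (hq : 1 / q + 1 / q' = 1) {f g : X → ℝ≥0∞} (hf : Measurable f) (hg : Measurable g) :
    ∫⁻ x, f x * g x ∂μ ≤ eLpNorm f q μ * eLpNorm g q' μ := by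
  have h_top : ∀ {f g : X → ℝ≥0∞}, Measurable f →
      ∫⁻ x, f x * g x ∂μ ≤ eLpNorm f 1 μ * eLpNorm g ∞ μ := by
    intro f g hf
    rw [eLpNorm_one_eq_lintegral_enorm, eLpNorm_exponent_top,
      ← lintegral_mul_const _ hf.enorm]
    refine lintegral_mono_ae ((enorm_ae_le_eLpNormEssSup g μ).mono fun x hx => ?_)
    exact mul_le_mul' le_rfl hx
  simp only [one_div] at hq
  have hq0 : q ≠ 0 := by rintro rfl; simp at hq
  have hq'0 : q' ≠ 0 := by rintro rfl; simp at hq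
  by_cases hqt : q = ∞
  · obtain rfl : q' = 1 := by simpa [hqt] using hq
    rw [hqt, mul_comm]
    simp_rw [mul_comm (f _)]
    exact h_top hg
  by_cases hqt' : q' = ∞
  · obtain rfl : q = 1 := by simpa [hqt'] using hq
    rw [hqt']
    exact h_top hf
  have hconj : q.toReal.HolderConjugate q'.toReal := by
    refine Real.holderConjugate_iff.2 ⟨?_, ?_⟩
    · rw [← ENNReal.toReal_one, ENNReal.toReal_lt_toReal ENNReal.one_ne_top hqt,
        ← ENNReal.inv_lt_one, ← hq]
      exact ENNReal.lt_add_right (ENNReal.inv_ne_top.2 hq0) (ENNReal.inv_ne_zero.2 hqt')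
    · rw [← ENNReal.toReal_inv, ← ENNReal.toReal_inv, ← ENNReal.toReal_add
        (ENNReal.inv_ne_top.2 hq0) (ENNReal.inv_ne_top.2 hq'0), hq, ENNReal.toReal_one]
  rw [eLpNorm_eq_lintegral_rpow_enorm_toReal hq0 hqt,
    eLpNorm_eq_lintegral_rpow_enorm_toReal hq'0 hqt']
  exact ENNReal.lintegral_mul_le_Lp_mul_Lq μ hconj hf.aemeasurable hg.aemeasurable

lemma eLpNorm_ofReal_eq {ρ : Measure X} {p : ℝ} (hp : 1 ≤ p) (g : X → ℝ≥0∞) :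
    eLpNorm g (ENNReal.ofReal p) ρ = (∫⁻ x, g x ^ p ∂ρ) ^ (1 / p) := by
  have hp0 : 0 < p := zero_lt_one.trans_le hp
  rw [eLpNorm_eq_lintegral_rpow_enorm_toReal (by simpa using hp0) ENNReal.ofReal_ne_top,
    ENNReal.toReal_ofReal hp0.le]
  rfl

/-- Minkowski's inequality for series of nonnegative functions. -/
lemma eLpNorm_tsum_le {ρ : Measure X} {p : ℝ} (hp : 1 ≤ p) {f : ℕ → X → ℝ≥0∞}
    (hf : ∀ j, Measurable (f j)) : eLpNorm (fun x => ∑' j, f j x) (ENNReal.ofReal p) ρ ≤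
      ∑' j, eLpNorm (f j) (ENNReal.ofReal p) ρ := by
  have hp0 : 0 < p := zero_lt_one.trans_le hp
  have hp1 : 1 ≤ ENNReal.ofReal p := ENNReal.one_le_ofReal.2 hp
  have hsup : ∀ x, (∑' j, f j x) ^ p = ⨆ N : ℕ, (∑ j ∈ Finset.range N, f j x) ^ p := by
    intro x
    have hmono : Monotone fun N : ℕ => ∑ j ∈ Finset.range N, f j x := fun a b hab =>
      Finset.sum_le_sum_of_subset (Finset.range_mono hab)
    rw [ENNReal.tsum_eq_iSup_nat]
    exact (ENNReal.monotone_rpow_of_nonneg hp0.le).map_iSup_of_continuousAt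
      (ENNReal.continuous_rpow_const.continuousAt) (by simp [hp0])
  rw [eLpNorm_ofReal_eq hp, one_div, ENNReal.rpow_inv_le_iff hp0]
  simp_rw [hsup]
  rw [lintegral_iSup (fun N => (Finset.measurable_sum _ fun j _ => hf j).pow_const p)
    (fun a b hab x => by
      dsimp only
      gcongr)]
  refine iSup_le fun N => ?_
  rw [← ENNReal.rpow_inv_le_iff hp0, ← one_div]
  have h1 := eLpNorm_sum_le (f := f) (s := Finset.range N) (p := ENNReal.ofReal p) (μ := ρ)
    (fun j _ => (hf j).aestronglyMeasurable) hp1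
  rw [eLpNorm_ofReal_eq hp] at h1
  simp only [Finset.sum_apply] at h1
  exact h1.trans (ENNReal.sum_le_tsum _)

lemma eLpNorm_lintegral_kernel_le {ρ : Measure X} {p : ℝ} (hp : 1 ≤ p) (κ : Kernel X X)
    [IsMarkovKernel κ] {g : X → ℝ≥0∞} (hg : Measurable g) :
    eLpNorm (fun x => ∫⁻ y, g y ∂(κ x)) (ENNReal.ofReal p) ρ ≤
      eLpNorm g (ENNReal.ofReal p) (ρ.bind κ) := by
  have hp0 : 0 < p := zero_lt_one.trans_le hp
  rw [eLpNorm_ofReal_eq hp, eLpNorm_ofReal_eq hp,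
    Measure.lintegral_bind κ.measurable.aemeasurable (hg.pow_const p).aemeasurable]
  gcongr with x
  have h1 := eLpNorm_le_eLpNorm_of_exponent_le (ENNReal.one_le_ofReal.2 hp)
    (hg.aestronglyMeasurable (μ := κ x))
  rw [eLpNorm_one_eq_lintegral_enorm, eLpNorm_ofReal_eq hp, one_div,
    ENNReal.le_rpow_inv_iff hp0] at h1
  exact h1

/-- Change of measure: Hölder's inequality for the density. -/
lemma eLpNorm_le_rnDeriv {η μ : Measure X} [IsProbabilityMeasure η] [IsProbabilityMeasure μ]
    (hη : η ≪ μ) {p : ℝ} (hp : 1 ≤ p) {q q' : ℝ≥0∞} (hq : 1 / q + 1 / q' = 1)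
    {g : X → ℝ≥0∞} (hg : Measurable g) :
    eLpNorm g (ENNReal.ofReal p) η ≤
      eLpNorm (η.rnDeriv μ) q μ ^ (1 / p) * eLpNorm g (ENNReal.ofReal p * q') μ := by
  have hp0 : 0 < p := zero_lt_one.trans_le hp
  have h1 := eLpNorm_enorm_rpow (p := q') (μ := μ) g hp0
  have h2 := lintegral_mul_le_eLpNorm_mul_eLpNorm (μ := μ) hq (Measure.measurable_rnDeriv η μ)
    (hg.pow_const p)
  rw [lintegral_rnDeriv_mul hη (hg.pow_const p).aemeasurable] at h2
  change eLpNorm (fun x => g x ^ p) q' μ = _ at h1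
  rw [h1, mul_comm q'] at h2
  rw [eLpNorm_ofReal_eq hp]
  calc _ ≤ (eLpNorm (η.rnDeriv μ) q μ * eLpNorm g (ENNReal.ofReal p * q') μ ^ p) ^ (1 / p) := by
        gcongr
    _ = _ := by
      rw [ENNReal.mul_rpow_of_nonneg _ _ (by positivity), one_div, ENNReal.rpow_rpow_inv hp0.ne']

/-- Jensen's inequality for a concave power, with weights `w` that need not have sum one. -/
lemma tsum_mul_rpow_le {ι : Type*} [Countable ι] {w c : ι → ℝ≥0∞} (hw0 : ∀ i, w i ≠ 0)
    (hwt : ∀ i, w i ≠ ∞) {p : ℝ} (hp : 1 ≤ p) :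
    ∑' i, w i * c i ^ (1 / p) ≤ (∑' i, w i) ^ (1 - 1 / p) * (∑' i, w i * c i) ^ (1 / p) := by
  have hp0 : 0 < p := zero_lt_one.trans_le hp
  have hp1 : 1 / p ≤ 1 := by rw [div_le_one hp0]; exact hp
  let _ : MeasurableSpace ι := ⊤
  have : MeasurableSingletonClass ι := ⟨fun _ => trivial⟩
  have h := ENNReal.lintegral_mul_norm_pow_le (μ := Measure.count) (f := w)
    (g := fun i => w i * c i) (measurable_from_top).aemeasurable
    (measurable_from_top).aemeasurable (sub_nonneg.2 hp1) (by positivity)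
    (sub_add_cancel 1 (1 / p))
  simp only [lintegral_count] at h
  refine le_trans (le_of_eq (tsum_congr fun i => ?_)) h
  rw [ENNReal.mul_rpow_of_nonneg _ _ (by positivity), ← mul_assoc,
    ← ENNReal.rpow_add _ _ (hw0 i) (hwt i), sub_add_cancel, ENNReal.rpow_one]

end LpEstimates

namespace ControlledChain

variable {Pol X : Type*} [MeasurableSpace X] {C : ControlledChain Pol X}

/-! ### Norms of the tails in terms of the concentrability coefficients -/

instance isProbabilityMeasure_push (ρ : Measure X) [IsProbabilityMeasure ρ] (L : List Pol) :
    IsProbabilityMeasure (C.push ρ L) := by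
  induction L generalizing ρ with
  | nil => assumption
  | cons π L ih =>
    have : IsProbabilityMeasure (ρ.bind (C.kernel π)) := by infer_instance
    exact ih _

/-- The maximizing policies in `Γ^n g` depend on `g`, but they form one list of length `n`. -/
lemma IsRegular.exists_eLpNorm_iterate_le (hC : C.IsRegular) {p : ℝ} (hp : 1 ≤ p)
    {g : X → ℝ≥0∞} (hg : Measurable g) (n : ℕ) : ∀ ρ : Measure X, ∃ L : List Pol, L.length = n ∧
      eLpNorm (C.maxStep^[n] g) (ENNReal.ofReal p) ρ ≤
        ENNReal.ofReal (C.γ ^ n) * eLpNorm g (ENNReal.ofReal p) (C.push ρ L) := by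
  have hp0 : 0 < p := zero_lt_one.trans_le hp
  induction n with
  | zero => exact fun ρ => ⟨[], rfl, by simp [push]⟩
  | succ n ih =>
    intro ρ
    have hm := hC.measurable_maxStep_iterate hg n
    obtain ⟨π, hπ⟩ := hC.exists_maxStep_eq hm
    obtain ⟨L, hL, hle⟩ := ih (ρ.bind (C.kernel π))
    refine ⟨π :: L, by simp [hL], ?_⟩
    have h1 : eLpNorm (C.maxStep^[n + 1] g) (ENNReal.ofReal p) ρ = ENNReal.ofReal C.γ *
        eLpNorm (fun x => ∫⁻ y, C.maxStep^[n] g y ∂(C.kernel π x)) (ENNReal.ofReal p) ρ := by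
      rw [Function.iterate_succ_apply', funext hπ, eLpNorm_ofReal_eq hp, eLpNorm_ofReal_eq hp]
      simp_rw [ENNReal.mul_rpow_of_nonneg _ _ hp0.le]
      rw [lintegral_const_mul _ (hm.lintegral_kernel.pow_const p),
        ENNReal.mul_rpow_of_nonneg _ _ (by positivity), one_div, ENNReal.rpow_rpow_inv hp0.ne']
    rw [h1, pow_succ', ENNReal.ofReal_mul hC.γ_pos.le, mul_assoc]
    exact mul_le_mul' le_rfl ((eLpNorm_lintegral_kernel_le hp _ hm).trans hle)

/-- Jensen's inequality over the double sum that defines `𝒞_q^{l,k,d}`, whose weights have total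
mass `(γ^l - γ^k) / (1 - γ)²`. -/
lemma IsRegular.sum_tsum_conc_le (hC : C.IsRegular) {p : ℝ} (hp : 1 ≤ p) (ρ μ : Measure X)
    (q : ℝ≥0∞) {l k : ℕ} (hlk : l < k) (d : ℕ) :
    ∑ i ∈ Finset.Ico l k,
        ∑' n, ENNReal.ofReal (C.γ ^ (i + n)) * C.conc ρ μ q (i + n + d) ^ (1 / p) ≤
      ENNReal.ofReal ((C.γ ^ l - C.γ ^ k) / (1 - C.γ) ^ 2) *
        C.concCoeff ρ μ q l k d ^ (1 / p) := by
  have hp0 : 0 < p := zero_lt_one.trans_le hp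
  have hγ := hC.γ_pos
  have h1 : 0 < 1 - C.γ := sub_pos.2 hC.γ_lt_one
  have hlk' : 0 < C.γ ^ l - C.γ ^ k :=
    sub_pos.2 (pow_lt_pow_right_of_lt_one₀ hγ hC.γ_lt_one hlk)
  have hprod : ∀ F : ℕ → ℕ → ℝ≥0∞, ∑ i ∈ Finset.Ico l k, ∑' n, F i n =
      ∑' x : ↥(Finset.Ico l k) × ℕ, F x.1 x.2 := by
    intro F
    rw [ENNReal.tsum_prod (f := fun (i : ↥(Finset.Ico l k)) n => F i n), tsum_fintype,
      Finset.sum_coe_sort (Finset.Ico l k) (fun i => ∑' n, F i n)]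
  set w : ↥(Finset.Ico l k) × ℕ → ℝ≥0∞ := fun x => ENNReal.ofReal (C.γ ^ ((x.1 : ℕ) + x.2))
  set c : ↥(Finset.Ico l k) × ℕ → ℝ≥0∞ := fun x => C.conc ρ μ q (x.1 + x.2 + d)
  set W : ℝ := (C.γ ^ l - C.γ ^ k) / (1 - C.γ) ^ 2 with hWdef
  have hW : 0 < W := by positivity
  have hsum : ∑' x, w x = ENNReal.ofReal W := by
    rw [← hprod fun i n => ENNReal.ofReal (C.γ ^ (i + n))]
    have hgeo : ∀ i, ∑' n, ENNReal.ofReal (C.γ ^ (i + n)) =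
        ENNReal.ofReal (C.γ ^ i * (1 - C.γ)⁻¹) := by
      intro i
      simp_rw [pow_add]
      rw [← tsum_geometric_of_lt_one hγ.le hC.γ_lt_one, ← tsum_mul_left,
        ENNReal.ofReal_tsum_of_nonneg (fun n => by positivity)
          ((summable_geometric_of_lt_one hγ.le hC.γ_lt_one).mul_left _)]
    simp_rw [hgeo]
    rw [← ENNReal.ofReal_sum_of_nonneg (fun i _ => by positivity), ← Finset.sum_mul,
      geom_sum_Ico hC.γ_lt_one.ne hlk.le, hWdef]
    congr 1
    have h2 : C.γ - 1 ≠ 0 := by linarith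
    field_simp
    ring
  have hcoeff : C.concCoeff ρ μ q l k d = (ENNReal.ofReal W)⁻¹ * ∑' x, w x * c x := by
    rw [concCoeff, ← hprod fun i n => ENNReal.ofReal (C.γ ^ (i + n)) * C.conc ρ μ q (i + n + d),
      ← ENNReal.ofReal_inv_of_pos hW, hWdef, inv_div]
  rw [hprod fun i n => ENNReal.ofReal (C.γ ^ (i + n)) * C.conc ρ μ q (i + n + d) ^ (1 / p)]
  refine (tsum_mul_rpow_le (w := w) (c := c) (fun x => ?_) (fun x => ENNReal.ofReal_ne_top)
    hp).trans (le_of_eq ?_)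
  · simp only [w, ne_eq, ENNReal.ofReal_eq_zero, not_le]
    positivity
  · have hW0 : ENNReal.ofReal W ≠ 0 := by simpa using hW
    rw [hsum, hcoeff, ENNReal.mul_rpow_of_nonneg _ _ (by positivity), ← mul_assoc]
    congr 1
    rw [ENNReal.inv_rpow, sub_eq_add_neg, ENNReal.rpow_add _ _ hW0 ENNReal.ofReal_ne_top,
      ENNReal.rpow_one, ENNReal.rpow_neg]

variable {ρ μ : Measure X} [IsProbabilityMeasure ρ] [IsProbabilityMeasure μ]

lemma IsRegular.eLpNorm_iterate_le (hC : C.IsRegular) {p : ℝ} (hp : 1 ≤ p)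
    {q q' : ℝ≥0∞} (hq : 1 / q + 1 / q' = 1) {n : ℕ}
    (hac : ∀ L : List Pol, L.length = n → C.push ρ L ≪ μ) {g : X → ℝ≥0∞} (hg : Measurable g) :
    eLpNorm (C.maxStep^[n] g) (ENNReal.ofReal p) ρ ≤
      ENNReal.ofReal (C.γ ^ n) * C.conc ρ μ q n ^ (1 / p) *
        eLpNorm g (ENNReal.ofReal p * q') μ := by
  obtain ⟨L, hL, hle⟩ := hC.exists_eLpNorm_iterate_le hp hg n ρ
  refine hle.trans ?_
  rw [mul_assoc]
  gcongr
  refine (eLpNorm_le_rnDeriv (hac L hL) hp hq hg).trans ?_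
  gcongr
  exact le_iSup (fun l : {l : List Pol // l.length = n} =>
    eLpNorm ((C.push ρ l.1).rnDeriv μ) q μ) ⟨L, hL⟩

lemma IsRegular.eLpNorm_tail_le (hC : C.IsRegular) {p : ℝ} (hp : 1 ≤ p)
    {q q' : ℝ≥0∞} (hq : 1 / q + 1 / q' = 1) (i d : ℕ)
    (hac : ∀ L : List Pol, i + d ≤ L.length → C.push ρ L ≪ μ) {g : X → ℝ≥0∞}
    (hg : Measurable g) : eLpNorm (C.tail (i + d) g) (ENNReal.ofReal p) ρ ≤
      ENNReal.ofReal (C.γ ^ d) *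
        (∑' n, ENNReal.ofReal (C.γ ^ (i + n)) * C.conc ρ μ q (i + n + d) ^ (1 / p)) *
        eLpNorm g (ENNReal.ofReal p * q') μ := by
  refine (eLpNorm_tsum_le hp fun j => hC.measurable_maxStep_iterate hg _).trans ?_
  rw [← ENNReal.tsum_mul_left, ← ENNReal.tsum_mul_right]
  refine ENNReal.tsum_le_tsum fun n => ?_
  refine (hC.eLpNorm_iterate_le hp hq (fun L hL => hac L (by omega)) hg).trans (le_of_eq ?_)
  rw [← mul_assoc, ← ENNReal.ofReal_mul (pow_nonneg hC.γ_pos.le _), ← pow_add,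
    show d + (i + n) = i + d + n by ring, show i + n + d = i + d + n by ring]

/-- A sum of tails of uniformly bounded functions, measured in `L^p(ρ)`. -/
lemma IsRegular.sum_eLpNorm_tail_le (hC : C.IsRegular) {p : ℝ} (hp : 1 ≤ p)
    {q q' : ℝ≥0∞} (hq : 1 / q + 1 / q' = 1) (l n d : ℕ)
    (hac : ∀ L : List Pol, l + d ≤ L.length → C.push ρ L ≪ μ) {g : ℕ → X → ℝ≥0∞}
    (hg : ∀ i < n, Measurable (g i)) {E : ℝ≥0∞}
    (hE : ∀ i < n, eLpNorm (g i) (ENNReal.ofReal p * q') μ ≤ E) :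
    ∑ i ∈ Finset.range n, eLpNorm (C.tail (l + i + d) (g i)) (ENNReal.ofReal p) ρ ≤
      ENNReal.ofReal (C.γ ^ d * ((C.γ ^ l - C.γ ^ (l + n)) / (1 - C.γ) ^ 2)) *
        C.concCoeff ρ μ q l (l + n) d ^ (1 / p) * E := by
  rcases Nat.eq_zero_or_pos n with rfl | hn
  · simp
  calc _ ≤ ∑ i ∈ Finset.range n, ENNReal.ofReal (C.γ ^ d) *
        (∑' j, ENNReal.ofReal (C.γ ^ (l + i + j)) * C.conc ρ μ q (l + i + j + d) ^ (1 / p)) *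
          E := by
        refine Finset.sum_le_sum fun i hi => ?_
        have hi := Finset.mem_range.1 hi
        refine (hC.eLpNorm_tail_le hp hq (l + i) d (fun L hL => hac L (by omega))
          (hg i hi)).trans ?_
        gcongr
        exact hE i hi
    _ = ENNReal.ofReal (C.γ ^ d) * (∑ i ∈ Finset.Ico l (l + n), ∑' j,
        ENNReal.ofReal (C.γ ^ (i + j)) * C.conc ρ μ q (i + j + d) ^ (1 / p)) * E := by
        rw [← Finset.sum_mul, ← Finset.mul_sum, Finset.sum_Ico_eq_sum_range,
          Nat.add_sub_cancel_left]
    _ ≤ _ := by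
        rw [ENNReal.ofReal_mul (pow_nonneg hC.γ_pos.le d),
          mul_assoc (ENNReal.ofReal (C.γ ^ d)) (ENNReal.ofReal _)]
        exact mul_le_mul' (mul_le_mul' le_rfl (hC.sum_tsum_conc_le hp ρ μ q (by omega) d)) le_rfl

end ControlledChain

namespace ControlledChain

variable {Pol X : Type*} [MeasurableSpace X] {C : ControlledChain Pol X}

/-! ### The loss of approximate modified policy iteration -/

section Loss

variable {ρ μ : Measure X} [IsProbabilityMeasure ρ] [IsProbabilityMeasure μ] {m : ℕ}
  {v ε ε' : ℕ → X → ℝ} {π : ℕ → Pol}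

/-- The bound on the loss, with the contribution of the evaluation errors left as the sum of the
tails in which they enter. -/
lemma IsAMPI.eLpNorm_loss_le (hC : C.IsRegular) (hm : 1 ≤ m) (h : C.IsAMPI m v ε ε' π)
    {p : ℝ} (hp : 1 ≤ p) {q q' : ℝ≥0∞} (hq : 1 / q + 1 / q' = 1)
    (hac : ∀ L : List Pol, L ≠ [] → C.push ρ L ≪ μ) (hac0 : ρ ≪ μ ∨ ∀ k, ε' (k + 1) = 0)
    (k : ℕ) :
    eLpNorm (fun x => C.optValue x - C.value (π (k + 1)) x) (ENNReal.ofReal p) ρ ≤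
      2 * ∑ i ∈ Finset.range k,
          eLpNorm (C.tail (1 + i) (fun x => ‖ε (k - i) x‖ₑ)) (ENNReal.ofReal p) ρ +
        ENNReal.ofReal ((1 - C.γ ^ (k + 1)) / (1 - C.γ) ^ 2) *
          C.concCoeff ρ μ q 0 (k + 1) 0 ^ (1 / p) *
          (⨆ j ∈ Finset.Icc 1 (k + 1), eLpNorm (ε' j) (ENNReal.ofReal p * q') μ) +
        C.initTerm ρ μ p q q' (k + 1) (v 0) (π 1) := by
  have hp1 : 1 ≤ ENNReal.ofReal p := ENNReal.one_le_ofReal.2 hp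
  have h1γ : 0 < 1 - C.γ := sub_pos.2 hC.γ_lt_one
  have hε : ∀ i < k, Measurable fun x => ‖ε (k - i) x‖ₑ := by
    intro i hi
    rw [show k - i = k - i - 1 + 1 by omega]
    exact (h.err _).1.enorm
  have hε' : ∀ i < k + 1, Measurable (pos (ε' (k + 1 - i))) := by
    intro i hi
    rw [show k + 1 - i = k - i + 1 by omega]
    exact measurable_pos (h.greedyErr _)
  have hgreedy : ∑ i ∈ Finset.range (k + 1),
        eLpNorm (C.tail i (pos (ε' (k + 1 - i)))) (ENNReal.ofReal p) ρ ≤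
      ENNReal.ofReal ((1 - C.γ ^ (k + 1)) / (1 - C.γ) ^ 2) *
        C.concCoeff ρ μ q 0 (k + 1) 0 ^ (1 / p) *
        (⨆ j ∈ Finset.Icc 1 (k + 1), eLpNorm (ε' j) (ENNReal.ofReal p * q') μ) := by
    -- the summand `i = 0` is the only one that involves `ρ` itself
    rcases hac0 with hac0 | hzero
    · have hacL : ∀ L : List Pol, 0 + 0 ≤ L.length → C.push ρ L ≪ μ := by
        intro L _
        by_cases hL : L = []
        · rw [hL]
          exact hac0
        · exact hac L hL
      have := hC.sum_eLpNorm_tail_le hp hq 0 (k + 1) 0 hacL hε'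
        (E := ⨆ j ∈ Finset.Icc 1 (k + 1), eLpNorm (ε' j) (ENNReal.ofReal p * q') μ) (by
          intro i hi
          refine le_trans ?_ (le_iSup₂ (f := fun j (_ : j ∈ Finset.Icc 1 (k + 1)) =>
            eLpNorm (ε' j) (ENNReal.ofReal p * q') μ) (k + 1 - i)
            (Finset.mem_Icc.2 ⟨by omega, by omega⟩))
          exact eLpNorm_mono_enorm fun x => pos_le_enorm _ x)
      simpa using this
    · refine le_of_eq_of_le (Finset.sum_eq_zero fun i hi => ?_) zero_le
      have hi := Finset.mem_range.1 hi
      have h0 : pos (ε' (k + 1 - i)) = 0 := by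
        rw [show k + 1 - i = k - i + 1 by omega, hzero]
        funext x
        simp [pos]
      rw [h0, tail_zero]
      exact eLpNorm_zero
  have hmain : ∀ D : X → ℝ≥0∞, Measurable D → (∀ n x, C.potential v ε' π 0 n x ≤
      2 * C.tail (n + 1) D x + C.tail n (pos (ε' 1)) x) →
      eLpNorm (fun x => C.optValue x - C.value (π (k + 1)) x) (ENNReal.ofReal p) ρ ≤
        2 * ∑ i ∈ Finset.range k,
            eLpNorm (C.tail (1 + i) (fun x => ‖ε (k - i) x‖ₑ)) (ENNReal.ofReal p) ρ +
          ENNReal.ofReal ((1 - C.γ ^ (k + 1)) / (1 - C.γ) ^ 2) *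
            C.concCoeff ρ μ q 0 (k + 1) 0 ^ (1 / p) *
            (⨆ j ∈ Finset.Icc 1 (k + 1), eLpNorm (ε' j) (ENNReal.ofReal p * q') μ) +
          ENNReal.ofReal (2 * C.γ ^ (k + 1) / (1 - C.γ)) *
            C.concCoeff ρ μ q (k + 1) (k + 1 + 1) 0 ^ (1 / p) *
            eLpNorm D (ENNReal.ofReal p * q') μ := by
    intro D hD hpot
    set T : X → ℝ≥0∞ := C.tail (k + 1) D with hT
    set F : ℕ → X → ℝ≥0∞ := fun i => C.tail (1 + i) (fun x => ‖ε (k - i) x‖ₑ) with hF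
    set G : ℕ → X → ℝ≥0∞ := fun i => C.tail i (pos (ε' (k + 1 - i))) with hG
    have hTm : Measurable T := hC.measurable_tail hD _
    have hFm : ∀ i ∈ Finset.range k, AEStronglyMeasurable (F i) ρ := fun i hi =>
      (hC.measurable_tail (hε i (Finset.mem_range.1 hi)) _).aestronglyMeasurable
    have hGm : ∀ i ∈ Finset.range (k + 1), AEStronglyMeasurable (G i) ρ := fun i hi =>
      (hC.measurable_tail (hε' i (Finset.mem_range.1 hi)) _).aestronglyMeasurable
    have hFs := Finset.aestronglyMeasurable_sum _ hFm
    have hGs := Finset.aestronglyMeasurable_sum _ hGm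
    have hTs := hTm.aestronglyMeasurable (μ := ρ)
    have hle : eLpNorm (fun x => C.optValue x - C.value (π (k + 1)) x) (ENNReal.ofReal p) ρ ≤
        eLpNorm ((T + T) + (∑ i ∈ Finset.range k, F i + ∑ i ∈ Finset.range k, F i) +
          ∑ i ∈ Finset.range (k + 1), G i) (ENNReal.ofReal p) ρ := by
      refine eLpNorm_mono_enorm fun x => (h.loss_le hC hm hpot k x).trans (le_of_eq ?_)
      simp only [hT, hF, hG, enorm_eq_self, Pi.add_apply, Finset.sum_apply, two_mul,
        add_comm 1]
    have hTle : eLpNorm T (ENNReal.ofReal p) ρ ≤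
        ENNReal.ofReal ((C.γ ^ (k + 1) - C.γ ^ (k + 1 + 1)) / (1 - C.γ) ^ 2) *
          C.concCoeff ρ μ q (k + 1) (k + 1 + 1) 0 ^ (1 / p) *
            eLpNorm D (ENNReal.ofReal p * q') μ := by
      have := hC.sum_eLpNorm_tail_le hp hq (k + 1) 1 0
        (fun L hL => hac L (by rintro rfl; simp at hL)) (g := fun _ => D) (fun _ _ => hD)
        (E := eLpNorm D (ENNReal.ofReal p * q') μ) (fun _ _ => le_rfl)
      simpa using this
    have hweight : 2 * ENNReal.ofReal ((C.γ ^ (k + 1) - C.γ ^ (k + 1 + 1)) / (1 - C.γ) ^ 2) =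
        ENNReal.ofReal (2 * C.γ ^ (k + 1) / (1 - C.γ)) := by
      rw [← ENNReal.ofReal_ofNat 2, ← ENNReal.ofReal_mul (by norm_num)]
      congr 1
      field_simp
      ring
    calc _ ≤ _ := hle
      _ ≤ (eLpNorm T (ENNReal.ofReal p) ρ + eLpNorm T (ENNReal.ofReal p) ρ) +
          (∑ i ∈ Finset.range k, eLpNorm (F i) (ENNReal.ofReal p) ρ +
            ∑ i ∈ Finset.range k, eLpNorm (F i) (ENNReal.ofReal p) ρ) +
          ∑ i ∈ Finset.range (k + 1), eLpNorm (G i) (ENNReal.ofReal p) ρ := by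
          refine (eLpNorm_add_le ((hTs.add hTs).add (hFs.add hFs)) hGs hp1).trans
            (add_le_add ?_ (eLpNorm_sum_le hGm hp1))
          refine (eLpNorm_add_le (hTs.add hTs) (hFs.add hFs) hp1).trans
            (add_le_add (eLpNorm_add_le hTs hTs hp1) ?_)
          exact (eLpNorm_add_le hFs hFs hp1).trans
            (add_le_add (eLpNorm_sum_le hFm hp1) (eLpNorm_sum_le hFm hp1))
      _ = 2 * ∑ i ∈ Finset.range k, eLpNorm (F i) (ENNReal.ofReal p) ρ +
          ∑ i ∈ Finset.range (k + 1), eLpNorm (G i) (ENNReal.ofReal p) ρ +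
            2 * eLpNorm T (ENNReal.ofReal p) ρ := by ring
      _ ≤ _ := by
          refine add_le_add (add_le_add le_rfl hgreedy) ?_
          rw [← hweight, mul_assoc 2, mul_assoc 2]
          exact mul_le_mul' le_rfl hTle
  have hgap := hmain _ (h.bddMeasurable_gap hC 0).1.enorm (h.potential_zero_le_gap hC)
  have hres := hmain _ (h.bddMeasurable_residual hC 0).1.enorm (h.potential_zero_le_residual hC)
  rw [eLpNorm_enorm] at hgap hres
  unfold initTerm
  rcases min_choice (eLpNorm (fun x => C.optValue x - v 0 x) (ENNReal.ofReal p * q') μ)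
    (eLpNorm (fun x => v 0 x - C.bellman (π 1) (v 0) x) (ENNReal.ofReal p * q') μ) with hc | hc
  · rw [hc]
    exact hgap
  · rw [hc]
    exact hres

/-- The AMPI bound; absolute continuity of `ρ` itself is not needed without greedy step errors. -/
lemma IsAMPI.eLpNorm_loss_le_iSup (hC : C.IsRegular) (hm : 1 ≤ m) (h : C.IsAMPI m v ε ε' π)
    {p : ℝ} (hp : 1 ≤ p) {q q' : ℝ≥0∞} (hq : 1 / q + 1 / q' = 1)
    (hac : ∀ L : List Pol, L ≠ [] → C.push ρ L ≪ μ) (hac0 : ρ ≪ μ ∨ ∀ k, ε' (k + 1) = 0)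
    (k : ℕ) :
    eLpNorm (fun x => C.optValue x - C.value (π (k + 1)) x) (ENNReal.ofReal p) ρ ≤
      ENNReal.ofReal (2 * (C.γ - C.γ ^ (k + 1)) / (1 - C.γ) ^ 2) *
          C.concCoeff ρ μ q 1 (k + 1) 0 ^ (1 / p) *
          (⨆ j ∈ Finset.Icc 1 k, eLpNorm (ε j) (ENNReal.ofReal p * q') μ) +
        ENNReal.ofReal ((1 - C.γ ^ (k + 1)) / (1 - C.γ) ^ 2) *
          C.concCoeff ρ μ q 0 (k + 1) 0 ^ (1 / p) *
          (⨆ j ∈ Finset.Icc 1 (k + 1), eLpNorm (ε' j) (ENNReal.ofReal p * q') μ) +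
        C.initTerm ρ μ p q q' (k + 1) (v 0) (π 1) := by
  refine (h.eLpNorm_loss_le hC hm hp hq hac hac0 k).trans
    (add_le_add (add_le_add ?_ le_rfl) le_rfl)
  have h1 := hC.sum_eLpNorm_tail_le hp hq 1 k 0
    (fun L hL => hac L (by rintro rfl; simp at hL)) (g := fun i x => ‖ε (k - i) x‖ₑ)
    (by
      intro i hi
      rw [show k - i = k - i - 1 + 1 by omega]
      exact (h.err _).1.enorm)
    (E := ⨆ j ∈ Finset.Icc 1 k, eLpNorm (ε j) (ENNReal.ofReal p * q') μ) (by
      intro i hi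
      rw [eLpNorm_enorm]
      exact le_iSup₂ (f := fun j (_ : j ∈ Finset.Icc 1 k) =>
        eLpNorm (ε j) (ENNReal.ofReal p * q') μ) (k - i)
        (Finset.mem_Icc.2 ⟨by omega, by omega⟩))
  simp only [pow_zero, one_mul, pow_one, add_zero, add_comm 1 k] at h1
  refine (mul_le_mul' le_rfl h1).trans (le_of_eq ?_)
  rw [mul_div_assoc, ENNReal.ofReal_mul zero_le_two, ENNReal.ofReal_ofNat]
  ring

/-- The error that CBMPI makes on the values before approximation: the effect of `ε_k` after the
`m` evaluation steps of the next iteration. There is none in the first iteration. -/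
noncomputable def delayedError (C : ControlledChain Pol X) (m : ℕ) (v : ℕ → X → ℝ)
    (π : ℕ → Pol) : ℕ → X → ℝ
  | 0 => 0
  | k + 1 => fun x => C.preValue m v π (k + 1) x -
      (C.bellman (π (k + 1)))^[m] (C.preValue m v π k) x

lemma IsCBMPI.bddMeasurable_preValue (hC : C.IsRegular) (h : C.IsCBMPI m v ε ε' π) (k : ℕ) :
    BddMeasurable (C.preValue m v π k) := by
  cases k with
  | zero => exact h.init
  | succ k => exact hC.bddMeasurable_bellman_iterate (h.bddMeasurable hC k) _ m

lemma delayedError_one : C.delayedError m v π 1 = 0 := by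
  funext x
  simp [delayedError, preValue]

/-- CBMPI is AMPI on the values before approximation, with the delayed errors. -/
lemma IsCBMPI.isAMPI (hC : C.IsRegular) (h : C.IsCBMPI m v ε ε' π) :
    C.IsAMPI m (C.preValue m v π) (C.delayedError m v π) ε' π where
  init := h.init
  err k := (h.bddMeasurable_preValue hC (k + 1)).sub
    (hC.bddMeasurable_bellman_iterate (h.bddMeasurable_preValue hC k) _ m)
  eval k x := by
    rw [delayedError]
    ring
  greedyErr := h.greedyErr
  greedy := h.greedy

lemma IsCBMPI.delayedError_le (hC : C.IsRegular) (h : C.IsCBMPI m v ε ε' π) (k : ℕ) :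
    (fun x => ‖C.delayedError m v π (k + 1 + 1) x‖ₑ) ≤
      C.maxStep^[m] (fun x => ‖ε (k + 1) x‖ₑ) := by
  have hv := h.bddMeasurable hC (k + 1)
  have hw := h.bddMeasurable_preValue hC (k + 1)
  have hvw : ∀ x, v (k + 1) x - C.preValue m v π (k + 1) x = ε (k + 1) x := by
    intro x
    rw [h.eval k x, preValue]
    ring
  intro x
  have hpos : pos (fun x => v (k + 1) x - C.preValue m v π (k + 1) x) ≤
      fun x => ‖ε (k + 1) x‖ₑ :=
    (pos_mono fun y => (hvw y).le).trans (pos_le_enorm (ε (k + 1)))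
  have hneg : pos (fun x => C.preValue m v π (k + 1) x - v (k + 1) x) ≤
      fun x => ‖ε (k + 1) x‖ₑ :=
    (pos_mono fun y => by rw [← hvw y]; linarith).trans (pos_neg_le_enorm (ε (k + 1)))
  have h1 := (pos_bellman_iterate_sub_le hC hv hw (π (k + 1 + 1)) m).trans
    (maxStep_iterate_mono m hpos) x
  have h2 := (pos_bellman_iterate_sub_le hC hw hv (π (k + 1 + 1)) m).trans
    (maxStep_iterate_mono m hneg) x
  change ‖(C.bellman (π (k + 1 + 1)))^[m] (v (k + 1)) x -
    (C.bellman (π (k + 1 + 1)))^[m] (C.preValue m v π (k + 1)) x‖ₑ ≤ _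
  rw [Real.enorm_eq_ofReal_abs]
  rcases abs_choice ((C.bellman (π (k + 1 + 1)))^[m] (v (k + 1)) x -
    (C.bellman (π (k + 1 + 1)))^[m] (C.preValue m v π (k + 1)) x) with habs | habs
  · rw [habs]
    exact h1
  · rw [habs, neg_sub]
    exact h2

lemma IsCBMPI.sum_tail_delayedError_le (hC : C.IsRegular) (h : C.IsCBMPI m v ε ε' π)
    {p : ℝ} (hp : 1 ≤ p) {q q' : ℝ≥0∞} (hq : 1 / q + 1 / q' = 1)
    (hac : ∀ L : List Pol, L ≠ [] → C.push ρ L ≪ μ) (k : ℕ) :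
    2 * ∑ i ∈ Finset.range k, eLpNorm (C.tail (1 + i)
        (fun x => ‖C.delayedError m v π (k - i) x‖ₑ)) (ENNReal.ofReal p) ρ ≤
      ENNReal.ofReal (2 * C.γ ^ m * (C.γ - C.γ ^ k) / (1 - C.γ) ^ 2) *
        C.concCoeff ρ μ q 1 k m ^ (1 / p) *
        (⨆ j ∈ Finset.Icc 1 (k - 1), eLpNorm (ε j) (ENNReal.ofReal p * q') μ) := by
  obtain _ | k := k
  · simp
  -- the last summand is the delayed error of the first iteration, which vanishes
  have hlast : eLpNorm (C.tail (1 + k)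
      (fun x => ‖C.delayedError m v π (k + 1 - k) x‖ₑ)) (ENNReal.ofReal p) ρ = 0 := by
    have h0 : (fun x => ‖C.delayedError m v π (k + 1 - k) x‖ₑ) = 0 := by
      funext x
      rw [Nat.add_sub_cancel_left, delayedError_one]
      simp
    rw [h0, tail_zero]
    exact eLpNorm_zero
  have hstep : ∀ i ∈ Finset.range k, eLpNorm (C.tail (1 + i)
      (fun x => ‖C.delayedError m v π (k + 1 - i) x‖ₑ)) (ENNReal.ofReal p) ρ ≤
        eLpNorm (C.tail (1 + i + m) (fun x => ‖ε (k - i) x‖ₑ)) (ENNReal.ofReal p) ρ := by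
    intro i hi
    have hi := Finset.mem_range.1 hi
    obtain ⟨n, hn⟩ := Nat.exists_eq_add_of_lt hi
    rw [show k + 1 - i = n + 1 + 1 by omega, show k - i = n + 1 by omega, ← tail_iterate (1 + i) m]
    exact eLpNorm_mono_enorm fun x => tail_mono (1 + i) (h.delayedError_le hC n) x
  have h1 := hC.sum_eLpNorm_tail_le hp hq 1 k m
    (fun L hL => hac L (by rintro rfl; simp at hL)) (g := fun i x => ‖ε (k - i) x‖ₑ)
    (by
      intro i hi
      rw [show k - i = k - i - 1 + 1 by omega]
      exact (h.err _).1.enorm)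
    (E := ⨆ j ∈ Finset.Icc 1 k, eLpNorm (ε j) (ENNReal.ofReal p * q') μ) (by
      intro i hi
      rw [eLpNorm_enorm]
      exact le_iSup₂ (f := fun j (_ : j ∈ Finset.Icc 1 k) =>
        eLpNorm (ε j) (ENNReal.ofReal p * q') μ) (k - i)
        (Finset.mem_Icc.2 ⟨by omega, by omega⟩))
  rw [Finset.sum_range_succ, hlast, add_zero, Nat.add_sub_cancel]
  rw [pow_one, add_comm 1 k] at h1
  refine (mul_le_mul' le_rfl ((Finset.sum_le_sum hstep).trans h1)).trans (le_of_eq ?_)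
  rw [mul_assoc 2 (C.γ ^ m), mul_div_assoc, ENNReal.ofReal_mul zero_le_two, ENNReal.ofReal_ofNat,
    mul_div_assoc]
  ring

end Loss

end ControlledChain

/-- AMPI-Q is AMPI on state-action pairs without greedy step errors. -/
lemma MDP.IsAMPIQ.isAMPI {S A : Type*} [MeasurableSpace S] [MeasurableSpace A]
    [Finite A] [Nonempty A] [MeasurableSingletonClass A] {M : MDP S A} {m : ℕ}
    {Q ε : ℕ → S × A → ℝ} {π : ℕ → Policy S A} (h : M.IsAMPIQ m Q ε π) :
    M.onStateActions.IsAMPI m Q ε 0 π where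
  toEvalStep := h.toEvalStep
  greedyErr _ := measurable_zero
  greedy k π' x := by
    have := M.bellman_onStateActions_le
      (h.bddMeasurable M.isRegular_onStateActions k) (h.greedy k) π' x
    simpa using this

theorem theorem1 {S A : Type*} [MeasurableSpace S] [MeasurableSpace A]
    [Finite A] [Nonempty A] [MeasurableSingletonClass A] (M : MDP S A)
    (m k : ℕ) (hm : 1 ≤ m) (hk : 1 ≤ k) (p : ℝ) (hp : 1 ≤ p)
    (q q' : ℝ≥0∞) (hq : 1 / q + 1 / q' = 1) :
    -- AMPI (AMPI-V)
    (∀ (ρ μ : Measure S) [IsProbabilityMeasure ρ] [IsProbabilityMeasure μ],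
      (∀ l : List (Policy S A), M.onStates.push ρ l ≪ μ) →
      ∀ (v ε ε' : ℕ → S → ℝ) (π : ℕ → Policy S A), M.onStates.IsAMPI m v ε ε' π →
      eLpNorm (fun s => M.onStates.optValue s - M.onStates.value (π k) s) (ENNReal.ofReal p) ρ ≤
        ENNReal.ofReal (2 * (M.γ - M.γ ^ k) / (1 - M.γ) ^ 2) *
            M.onStates.concCoeff ρ μ q 1 k 0 ^ (1 / p) *
            (⨆ j ∈ Finset.Icc 1 (k - 1), eLpNorm (ε j) (ENNReal.ofReal p * q') μ) +
          ENNReal.ofReal ((1 - M.γ ^ k) / (1 - M.γ) ^ 2) *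
            M.onStates.concCoeff ρ μ q 0 k 0 ^ (1 / p) *
            (⨆ j ∈ Finset.Icc 1 k, eLpNorm (ε' j) (ENNReal.ofReal p * q') μ) +
          M.onStates.initTerm ρ μ p q q' k (v 0) (π 1)) ∧
    -- AMPI-Q: the same bound for action-value functions, with zero greedy step errors
    (∀ (ρ μ : Measure (S × A)) [IsProbabilityMeasure ρ] [IsProbabilityMeasure μ],
      (∀ l : List (Policy S A), l ≠ [] → M.onStateActions.push ρ l ≪ μ) →
      ∀ (Q ε : ℕ → S × A → ℝ) (π : ℕ → Policy S A), M.IsAMPIQ m Q ε π →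
      eLpNorm (fun x => M.onStateActions.optValue x - M.onStateActions.value (π k) x)
          (ENNReal.ofReal p) ρ ≤
        ENNReal.ofReal (2 * (M.γ - M.γ ^ k) / (1 - M.γ) ^ 2) *
            M.onStateActions.concCoeff ρ μ q 1 k 0 ^ (1 / p) *
            (⨆ j ∈ Finset.Icc 1 (k - 1), eLpNorm (ε j) (ENNReal.ofReal p * q') μ) +
          M.onStateActions.initTerm ρ μ p q q' k (Q 0) (π 1)) ∧
    -- CBMPI
    (∀ (ρ μ : Measure S) [IsProbabilityMeasure ρ] [IsProbabilityMeasure μ],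
      (∀ l : List (Policy S A), M.onStates.push ρ l ≪ μ) →
      ∀ (v ε ε' : ℕ → S → ℝ) (π : ℕ → Policy S A), M.onStates.IsCBMPI m v ε ε' π →
      eLpNorm (fun s => M.onStates.optValue s - M.onStates.value (π k) s) (ENNReal.ofReal p) ρ ≤
        ENNReal.ofReal (2 * M.γ ^ m * (M.γ - M.γ ^ (k - 1)) / (1 - M.γ) ^ 2) *
            M.onStates.concCoeff ρ μ q 1 (k - 1) m ^ (1 / p) *
            (⨆ j ∈ Finset.Icc 1 (k - 2), eLpNorm (ε j) (ENNReal.ofReal p * q') μ) +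
          ENNReal.ofReal ((1 - M.γ ^ k) / (1 - M.γ) ^ 2) *
            M.onStates.concCoeff ρ μ q 0 k 0 ^ (1 / p) *
            (⨆ j ∈ Finset.Icc 1 k, eLpNorm (ε' j) (ENNReal.ofReal p * q') μ) +
          M.onStates.initTerm ρ μ p q q' k (v 0) (π 1)) := by
  obtain ⟨k, rfl⟩ := Nat.exists_eq_add_of_le' hk
  refine ⟨?_, ?_, ?_⟩
  · intro ρ μ _ _ hac v ε ε' π h
    exact h.eLpNorm_loss_le_iSup M.isRegular_onStates hm hp hq (fun L _ => hac L)
      (Or.inl (hac [])) k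
  · intro ρ μ _ _ hac Q ε π h
    refine (h.isAMPI.eLpNorm_loss_le_iSup M.isRegular_onStateActions hm hp hq hac
      (Or.inr fun _ => rfl) k).trans (le_of_eq ?_)
    have h0 : (⨆ j ∈ Finset.Icc 1 (k + 1), eLpNorm ((0 : ℕ → S × A → ℝ) j)
        (ENNReal.ofReal p * q') μ) = 0 := by
      simp
    rw [h0, mul_zero, add_zero]
    rfl
  · intro ρ μ _ _ hac v ε ε' π h
    refine ((h.isAMPI M.isRegular_onStates).eLpNorm_loss_le M.isRegular_onStates hm hp hq
      (fun L _ => hac L) (Or.inl (hac [])) k).trans (add_le_add (add_le_add ?_ le_rfl) le_rfl)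
    exact h.sum_tail_delayedError_le M.isRegular_onStates hp hq (fun L _ => hac L) k
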